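/- **Setting.** Let $A$ be a finite or countably infinite alphabet and $k\ge 0$. A source $\mu$ (the law of a random sequence $x_1,x_2,\dots$ in $A$) is $k$-order Markov if $\mu(x_{n+1}=a\mid x_1=a_1,\dots,x_n=a_n)=\mu(x_{k+1}=a\mid x_1=a_{n-k+1},\dots,x_k=a_n)$ for all $n\ge k$ and all $a,a_1,\dots,a_n\in A$ such that the event $x_1=a_1,\dots,x_n=a_n$ has positive probability. Alice has a covertext sequence $x_1,x_2,\dots$ drawn from $\mu$, a secret sequence $y_1,y_2,\dots$ and a private random sequence, the last two consisting of i.i.d. equiprobable bits; the three sequences are independent. **The stegosystem $St^k_n(A)$** (it does not depend on $\mu$). The covertexts are cut into blocks of length $n>2k$. For a block $u\in A^n$ let $S_u$ be the set of all $v\in A^n$ in which every word of length $k+1$ occurs as a subword exactly as often as in $u$, and whose first $k$ and last $k$ symbols are those of $u$. Fix an enumeration $S_u=\{s_0,\dots,s_{N-1}\}$, $N=|S_u|$, depending only on the set $S_u$, put $m=\lfloor\log_2 N\rfloor$, and let $N=\sum_{l=0}^m\alpha_l2^l$ with $\alpha_l\in\{0,1\}$. From fresh private random bits Alice generates $\Delta$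 with $P(\Delta=i)=\alpha_i2^i/N$ for $0\le i\le m$ (taking only values $i$ with $\alpha_i=1$). If $\Delta=d$, she reads the next $d$ unused secret bits as an integer $r\in\{0,\dots,2^d-1\}$ and transmits in place of $u$ the word $s_\tau$, where $\tau=\sum_{l=d+1}^m\alpha_l2^l+r$. From the transmitted word one recovers $S_u$, $\tau$, $d$ and the $d$ secret bits. Let $L_{n}$ be the expected number of secret bits hidden in the first $T$ blocks, divided by $nT$, where $T\ge1$ is the number of blocks averaged over. **Theorem.** Let $\mu$ be a $k$-order Markov source, and let $St^k_n(A)$ be used with any choice of the enumerations and of the method of generating $\Delta$. (i) For every $n>2k$, every transmitted block lies in the set $S_u$ of the corresponding covertext block $u$, and $St^k_n(A)$ is perfectly secure: the transmitted sequence $X_1,X_2,\dots$ has the same distribution $\mu$ as the covertext sequence $x_1,x_2,\dots$. (ii) If $A$ is finite and $\mu$ is stationary (shift-invariant), then the expected number of hidden bits is finite and $L_n$ tends, as $n\to\infty$, to the $k$-order conditional entropy $$h_k(\mu)=-\sum_{v\in A^k}\mu(v)\sum_{a\in A}\mu(a\mid v)\log_2\mu(a\mid v),$$ where $\mu(v)=\mu(x_1\dots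 x_k=v)$ and $\mu(a\mid v)=\mu(x_{k+1}=a\mid x_1\dots x_k=v)$ (terms with $\mu(v)=0$ or $\mu(a\mid v)=0$ count as $0$); this holds whatever numbers $T=T_n\ge1$ of blocks are averaged over. -/

import Mathlib

open MeasureTheory ProbabilityTheory Filter Topology
open scoped ENNReal

noncomputable section

namespace Stego

/-! ### Sources and the steganographic protocol -/

/-- The law of an infinite sequence of i.i.d. equiprobable bits. -/
def fairBits : Measure (ℕ → Bool) :=
  Measure.infinitePi fun _ => (PMF.uniformOfFintype Bool).toMeasure

instance : IsProbabilityMeasure fairBits := by unfold fairBits; infer_instance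

/-- A stegosystem with block length `n` on the alphabet `A`.  The encoder maps a block of covertexts,
a sequence of secret bits and a sequence of private random bits to the transmitted block; the decoder
maps a block to a finite word of bits.  Decoding is always correct: what is decoded from a
transmitted block is an initial segment of the secret sequence that was presented to the encoder. -/
structure Stegosystem (A : Type*) (n : ℕ) where
  encode : (Fin n → A) → (ℕ → Bool) → (ℕ → Bool) → (Fin n → A)
  decode : (Fin n → A) → List Bool
  decode_encode : ∀ u y δ, decode (encode u y δ) =
    (List.range (decode (encode u y δ)).length).map y

/-- A sample point of the protocol: the covertext sequence `x`, the secret sequence `y` and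
Alice's private random sequence `δ`. -/
abbrev Outcome (A : Type*) : Type _ := (ℕ → A) × (ℕ → Bool) × (ℕ → Bool)

/-- The probability governing the protocol: the covertexts have law `μ`, the secret and the private
bits are i.i.d. equiprobable, and the three sequences are independent. -/
def protocolMeasure {A : Type*} [MeasurableSpace A] (μ : Measure (ℕ → A)) :
    Measure (Outcome A) :=
  μ.prod (fairBits.prod fairBits)

/-- The `b`-th block of length `n` of a sequence. -/
def block {A : Type*} (n : ℕ) (x : ℕ → A) (b : ℕ) : Fin n → A := fun t => x (n * b + t)

namespace Stegosystem

variable {A : Type*} {n : ℕ}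

/-- The transmitted block obtained from the `b`-th covertext block when `p` secret bits have already
been used.  The private sequence is split into disjoint subsequences, one for each block. -/
def sendBlock (S : Stegosystem A n) (ω : Outcome A) (b p : ℕ) : Fin n → A :=
  S.encode (block n ω.1 b) (fun j => ω.2.1 (p + j)) (fun j => ω.2.2 (Nat.pair b j))

/-- The number of secret bits hidden in the first `b` blocks. -/
def hiddenBits (S : Stegosystem A n) (ω : Outcome A) : ℕ → ℕ
  | 0 => 0
  | b + 1 => hiddenBits S ω b + (S.decode (S.sendBlock ω b (hiddenBits S ω b))).length

/-- The transmitted (steganographic) sequence. -/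
def stegoSequence (S : Stegosystem A n) (hn : 0 < n) (ω : Outcome A) : ℕ → A :=
  fun i => S.sendBlock ω (i / n) (S.hiddenBits ω (i / n)) ⟨i % n, Nat.mod_lt i hn⟩

/-- Perfect security: the covertext sequence and the steganographic sequence have the same law. -/
def PerfectlySecure [MeasurableSpace A] (S : Stegosystem A n) (hn : 0 < n)
    (μ : Measure (ℕ → A)) : Prop :=
  IdentDistrib (S.stegoSequence hn) (fun ω => ω.1) (protocolMeasure μ) (protocolMeasure μ)

/-- The expected number of secret bits hidden in the first `T` blocks, per letter of covertext. -/
def rate [MeasurableSpace A] (S : Stegosystem A n) (μ : Measure (ℕ → A)) (T : ℕ) : ℝ :=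
  (∫ ω, (S.hiddenBits ω T : ℝ) ∂protocolMeasure μ) / ((n : ℝ) * (T : ℝ))

end Stegosystem

/-! ### Markov sources -/

/-- `μ` is `k`-order Markov: whenever `x₁ … xₙ = a₁ … aₙ` (`n ≥ k`) has positive probability,
`μ(xₙ₊₁ = c | x₁ … xₙ = a₁ … aₙ) = μ(xₖ₊₁ = c | x₁ … xₖ = aₙ₋ₖ₊₁ … aₙ)`.
Sequences are indexed from `0` here. -/
def IsMarkovSource {A : Type*} [MeasurableSpace A] (k : ℕ) (μ : Measure (ℕ → A)) : Prop :=
  ∀ n, k ≤ n → ∀ (a : ℕ → A) (c : A), μ {x | ∀ i < n, x i = a i} ≠ 0 →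
    μ[{x | x n = c} | {x | ∀ i < n, x i = a i}] =
      μ[{x | x k = c} | {x | ∀ i < k, x i = a (n - k + i)}]

/-- `μ` is stationary: its law is invariant under the shift. -/
def IsStationarySource {A : Type*} [MeasurableSpace A] (μ : Measure (ℕ → A)) : Prop :=
  MeasurePreserving (fun (x : ℕ → A) i => x (i + 1)) μ μ

/-- The `k`-order conditional Shannon entropy, in bits:
`h_k(μ) = - ∑_{v ∈ A^k} μ(v) ∑_{c ∈ A} μ(c | v) log₂ μ(c | v)`. -/
def condEntropy {A : Type*} [MeasurableSpace A] [Fintype A] (k : ℕ) (μ : Measure (ℕ → A)) : ℝ :=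
  -∑ v : Fin k → A, μ.real {x | ∀ i : Fin k, x i = v i} *
    ∑ c : A, (μ[{x | x k = c} | {x | ∀ i : Fin k, x i = v i}]).toReal *
      Real.logb 2 (μ[{x | x k = c} | {x | ∀ i : Fin k, x i = v i}]).toReal

/-! ### The set `S_u` -/

section TypeClass

variable {A : Type*} {n : ℕ}

/-- The number of occurrences of the word `s` of length `k + 1` as a subword of `u`. -/
def occ (k : ℕ) (u : Fin n → A) (s : Fin (k + 1) → A) : ℕ :=
  Set.ncard {i : ℕ | ∃ h : i + k < n, ∀ j : Fin (k + 1), u ⟨i + j, by omega⟩ = s j}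

/-- The words with the same `(k + 1)`-subword counts and the same first and last `k` symbols as
`u`. -/
def typeSet (k : ℕ) (u : Fin n → A) : Set (Fin n → A) :=
  {v | (∀ s, occ k v s = occ k u s) ∧ ∀ t : Fin n, (t : ℕ) < k ∨ n ≤ t + k → v t = u t}

theorem occ_pos_iff (k : ℕ) (u : Fin n → A) (s : Fin (k + 1) → A) :
    0 < occ k u s ↔ ∃ i, ∃ h : i + k < n, ∀ j : Fin (k + 1), u ⟨i + j, by omega⟩ = s j := by
  have hf : {i : ℕ | ∃ h : i + k < n, ∀ j : Fin (k + 1), u ⟨i + j, by omega⟩ = s j}.Finite :=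
    (Set.finite_Iio n).subset fun i ⟨h, _⟩ => by simp only [Set.mem_Iio]; omega
  exact Set.ncard_pos hf

theorem typeSet_finite (k : ℕ) (u : Fin n → A) : (typeSet k u).Finite := by
  refine (Set.Finite.pi' fun _ : Fin n => Set.finite_range u).subset ?_
  rintro v ⟨hc, he⟩ t
  by_cases ht : (t : ℕ) < k
  · exact ⟨t, (he t (Or.inl ht)).symm⟩
  · have h1 : 0 < occ k v fun j => v ⟨(t - k) + j, by omega⟩ :=
      (occ_pos_iff _ _ _).2 ⟨t - k, by omega, fun j => rfl⟩
    rw [hc] at h1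
    obtain ⟨i, h, hj⟩ := (occ_pos_iff _ _ _).1 h1
    refine ⟨_, (hj ⟨k, by omega⟩).trans ?_⟩
    congr 1
    ext
    simp only
    omega

/-- The set `S_u` as a finite set of words. -/
def typeClass (k : ℕ) (u : Fin n → A) : Finset (Fin n → A) := (typeSet_finite k u).toFinset

theorem self_mem_typeClass (k : ℕ) (u : Fin n → A) : u ∈ typeClass k u := by
  simp [typeClass, typeSet]

theorem typeClass_eq {k : ℕ} {u v : Fin n → A} (h : v ∈ typeClass k u) :
    typeClass k v = typeClass k u := by
  simp only [typeClass, Set.Finite.mem_toFinset] at h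
  obtain ⟨h1, h2⟩ := h
  ext w
  simp only [typeClass, Set.Finite.mem_toFinset, typeSet, Set.mem_ofPred_eq, h1]
  refine and_congr_right fun _ => forall_congr' fun t => forall_congr' fun ht => ?_
  rw [h2 t ht]

theorem typeClass_card_pos (k : ℕ) (u : Fin n → A) : 0 < (typeClass k u).card :=
  Finset.card_pos.2 ⟨u, self_mem_typeClass k u⟩

end TypeClass

/-! ### Splitting `{0, …, N - 1}` along the binary expansion of `N` -/

/-- `∑_{l = d}^{m} α_l 2^l`, where `(α_m, …, α_0)` is the binary expansion of `N` and
`m = ⌊log₂ N⌋`. -/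
def topPart (N d : ℕ) : ℕ :=
  ∑ l ∈ Finset.Icc d (Nat.log 2 N), (N.testBit l).toNat * 2 ^ l

/-- The largest `d ≤ m` with `α_d ≠ 0` and `τ < ∑_{l = d}^{m} α_l 2^l`. -/
def segment (N τ : ℕ) : ℕ :=
  Nat.findGreatest (fun d => N.testBit d = true ∧ τ < topPart N d) (Nat.log 2 N)

theorem topPart_of_log_lt {N d : ℕ} (h : Nat.log 2 N < d) : topPart N d = 0 := by
  simp [topPart, h]

theorem topPart_succ (N d : ℕ) :
    topPart N d = topPart N (d + 1) + (N.testBit d).toNat * 2 ^ d := by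
  by_cases h : d ≤ Nat.log 2 N
  · unfold topPart
    rw [← Finset.insert_Icc_add_one_left_eq_Icc h, Finset.sum_insert (by simp), add_comm]
  · push Not at h
    rw [topPart_of_log_lt h, topPart_of_log_lt (by omega),
      Nat.testBit_lt_two_pow ((Nat.lt_pow_succ_log_self (by norm_num) N).trans_le
        (Nat.pow_le_pow_right (by norm_num) h))]
    simp

theorem topPart_antitone (N : ℕ) : Antitone (topPart N) :=
  antitone_nat_of_succ_le fun d => by rw [topPart_succ N d]; omega

theorem topPart_eq (N d : ℕ) : topPart N d = N / 2 ^ d * 2 ^ d := by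
  by_cases h : Nat.log 2 N < d
  · rw [topPart_of_log_lt h, Nat.div_eq_of_lt (Nat.lt_pow_of_log_lt (by norm_num) h), zero_mul]
  · rw [topPart_succ, topPart_eq N (d + 1), pow_succ, ← Nat.div_div_eq_div_mul, Nat.toNat_testBit]
    conv_rhs => rw [← Nat.div_add_mod (N / 2 ^ d) 2]
    ring
  termination_by Nat.log 2 N + 1 - d

theorem topPart_zero (N : ℕ) : topPart N 0 = N := by simp [topPart_eq]

theorem topPart_add_lt {N d r : ℕ} (hd : N.testBit d = true) (hr : r < 2 ^ d) :
    topPart N (d + 1) + r < N := by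
  have h1 := topPart_succ N d
  have h2 := topPart_antitone N (Nat.zero_le d)
  rw [topPart_zero] at h2
  simp only [hd, Bool.toNat_true] at h1
  omega

theorem segment_eq {N d r : ℕ} (hd : N.testBit d = true) (hr : r < 2 ^ d) :
    segment N (topPart N (d + 1) + r) = d := by
  have h1 := topPart_succ N d
  simp only [hd, Bool.toNat_true] at h1
  rw [segment, Nat.findGreatest_eq_iff]
  refine ⟨?_, fun _ => ⟨hd, by omega⟩, fun e he _ h => ?_⟩
  · by_contra h
    push Not at h
    rw [topPart_of_log_lt h] at h1
    have := Nat.two_pow_pos d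
    omega
  · have := topPart_antitone N (show d + 1 ≤ e by omega)
    omega

theorem exists_segment {N τ : ℕ} (h : τ < N) :
    ∃ d r, N.testBit d = true ∧ r < 2 ^ d ∧ τ = topPart N (d + 1) + r := by
  have h0 : τ < topPart N 0 := by rwa [topPart_zero]
  have h1 : τ < topPart N (Nat.findGreatest (fun d => τ < topPart N d) (Nat.log 2 N)) :=
    Nat.findGreatest_spec (P := fun d => τ < topPart N d) (Nat.zero_le _) h0
  have h2 : ¬ τ < topPart N (Nat.findGreatest (fun d => τ < topPart N d) (Nat.log 2 N) + 1) := by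
    by_cases hm : Nat.findGreatest (fun d => τ < topPart N d) (Nat.log 2 N) + 1 ≤ Nat.log 2 N
    · exact Nat.findGreatest_is_greatest (P := fun d => τ < topPart N d) (Nat.lt_succ_self _) hm
    · rw [topPart_of_log_lt (by omega)]; omega
  set d := Nat.findGreatest (fun d => τ < topPart N d) (Nat.log 2 N)
  have h3 := topPart_succ N d
  have hb : N.testBit d = true := by
    by_contra hb
    simp only [Bool.not_eq_true] at hb
    simp only [hb, Bool.toNat_false] at h3
    omega
  simp only [hb, Bool.toNat_true] at h3
  exact ⟨d, τ - topPart N (d + 1), hb, by omega, by omega⟩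

/-! ### The random variable `Δ` -/

/-- A way to generate `Δ` from private fair bits: for every `N ≥ 1`, `pick N` takes the value `d`
with probability `α_d 2^d / N`, where `(α_m, …, α_0)` is the binary expansion of `N`, and it only
takes values `d` with `α_d = 1`. -/
structure DeltaSampler where
  pick : ℕ → (ℕ → Bool) → ℕ
  measurable_pick : ∀ N, Measurable (pick N)
  testBit_pick : ∀ N, N ≠ 0 → ∀ δ, N.testBit (pick N δ) = true
  law_pick : ∀ N, N ≠ 0 → ∀ d,
    fairBits {δ | pick N δ = d} = ((N.testBit d).toNat : ℝ≥0∞) * 2 ^ d / N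

/-- The real number with binary digits `δ`. -/
def bitsReal (δ : ℕ → Bool) : ℝ := Real.ofDigits fun i => (if δ i then 1 else 0 : Fin 2)

/-- The integer with the binary digits `δ 0, …, δ (q - 1)`, most significant digit first. -/
def headNat (δ : ℕ → Bool) : ℕ → ℕ
  | 0 => 0
  | q + 1 => 2 * headNat δ q + (δ q).toNat

theorem measurable_bitsReal : Measurable bitsReal :=
  Real.continuous_ofDigits.measurable.comp
    (measurable_pi_lambda _ fun i => (measurable_of_countable
      (fun b : Bool => (if b then 1 else 0 : Fin 2))).comp (measurable_pi_apply i))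

theorem bitsReal_mem (δ : ℕ → Bool) (q : ℕ) :
    (headNat δ q : ℝ) ≤ 2 ^ q * bitsReal δ ∧ 2 ^ q * bitsReal δ ≤ headNat δ q + 1 := by
  have hs : (2 : ℝ) ^ q * ∑ i ∈ Finset.range q,
      Real.ofDigitsTerm (fun i => (if δ i then 1 else 0 : Fin 2)) i = headNat δ q := by
    induction q with
    | zero => simp [headNat]
    | succ q ih =>
      rw [Finset.sum_range_succ, mul_add, pow_succ, mul_right_comm, ih, headNat]
      have h2 : (2 : ℝ) ^ q ≠ 0 := by positivity
      cases h : δ q <;> simp [Real.ofDigitsTerm, h, pow_succ] <;> field_simp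
  have h := Real.ofDigits_eq_sum_add_ofDigits (fun i => (if δ i then 1 else 0 : Fin 2)) q
  have h0 := Real.ofDigits_nonneg fun i => (if δ (i + q) then 1 else 0 : Fin 2)
  have h1 := Real.ofDigits_le_one fun i => (if δ (i + q) then 1 else 0 : Fin 2)
  have : 2 ^ q * bitsReal δ =
      headNat δ q + Real.ofDigits fun i => (if δ (i + q) then 1 else 0 : Fin 2) := by
    rw [bitsReal, h, mul_add, hs, ← mul_assoc]
    simp
  constructor <;> linarith

theorem headNat_testBit (δ : ℕ → Bool) (q : ℕ) :
    ∀ i < q, δ i = (headNat δ q).testBit (q - 1 - i) := by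
  induction q with
  | zero => intro i hi; omega
  | succ q ih =>
    intro i hi
    rcases Nat.lt_succ_iff_lt_or_eq.1 hi with h | rfl
    · rw [ih i h, headNat, show q + 1 - 1 - i = (q - 1 - i) + 1 by omega, Nat.testBit_succ]
      congr 1
      cases δ q <;> simp <;> omega
    · cases h : δ i <;> simp [headNat, h, Nat.testBit_zero]

theorem fairBits_headNat_le (q c : ℕ) : fairBits {δ | headNat δ q = c} ≤ 2⁻¹ ^ q := by
  calc fairBits {δ | headNat δ q = c}
      ≤ fairBits (Set.pi (Finset.range q : Finset ℕ) fun i => {c.testBit (q - 1 - i)}) := by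
        refine measure_mono fun δ hδ i hi => ?_
        have := headNat_testBit δ q i (by simpa using hi)
        rw [Set.mem_ofPred_eq] at hδ
        rwa [hδ] at this
    _ = 2⁻¹ ^ q := by
        rw [fairBits, Measure.infinitePi_pi _ (fun i _ => measurableSet_singleton _)]
        simp

theorem fairBits_bitsReal_le {a b : ℝ} (h0 : 0 ≤ a) (hab : a ≤ b) :
    fairBits {δ | a ≤ bitsReal δ ∧ bitsReal δ ≤ b} ≤ ENNReal.ofReal (b - a) := by
  have hq : ∀ q : ℕ, fairBits {δ | a ≤ bitsReal δ ∧ bitsReal δ ≤ b} ≤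
      ENNReal.ofReal (b - a + 2 * 2⁻¹ ^ q) := by
    intro q
    have h2 : (0 : ℝ) < 2 ^ q := by positivity
    have hsub : {δ | a ≤ bitsReal δ ∧ bitsReal δ ≤ b} ⊆
        ⋃ c ∈ Finset.Icc (⌈2 ^ q * a⌉₊ - 1) ⌊2 ^ q * b⌋₊, {δ | headNat δ q = c} := by
      rintro δ ⟨h3, h4⟩
      simp only [Set.mem_iUnion, Finset.mem_Icc]
      obtain ⟨h5, h6⟩ := bitsReal_mem δ q
      refine ⟨_, ⟨?_, Nat.le_floor (h5.trans (by gcongr))⟩, rfl⟩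
      rw [Nat.sub_le_iff_le_add, Nat.ceil_le]
      push_cast
      exact le_trans (by gcongr) h6
    have hcard : ((Finset.Icc (⌈2 ^ q * a⌉₊ - 1) ⌊2 ^ q * b⌋₊).card : ℝ) ≤
        2 ^ q * (b - a) + 2 := by
      rw [Nat.card_Icc]
      have h3 : (⌊2 ^ q * b⌋₊ : ℝ) ≤ 2 ^ q * b := Nat.floor_le (by have := h0.trans hab; positivity)
      have h4 : 2 ^ q * a ≤ ⌈2 ^ q * a⌉₊ := Nat.le_ceil _
      have h5 : 2 ^ q * a ≤ 2 ^ q * b := by gcongr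
      by_cases h : ⌈2 ^ q * a⌉₊ - 1 ≤ ⌊2 ^ q * b⌋₊ + 1
      · rw [Nat.cast_sub h]
        have h6 : (⌈2 ^ q * a⌉₊ : ℝ) ≤ ((⌈2 ^ q * a⌉₊ - 1 : ℕ) : ℝ) + 1 := by
          exact_mod_cast (by omega : ⌈2 ^ q * a⌉₊ ≤ ⌈2 ^ q * a⌉₊ - 1 + 1)
        push_cast
        linarith
      · rw [Nat.sub_eq_zero_of_le (by omega)]
        simp only [Nat.cast_zero]
        linarith
    calc _ ≤ _ := measure_mono hsub
      _ ≤ ∑ c ∈ Finset.Icc (⌈2 ^ q * a⌉₊ - 1) ⌊2 ^ q * b⌋₊, fairBits {δ | headNat δ q = c} :=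
        measure_biUnion_finset_le _ _
      _ ≤ ∑ c ∈ Finset.Icc (⌈2 ^ q * a⌉₊ - 1) ⌊2 ^ q * b⌋₊, ENNReal.ofReal (2⁻¹ ^ q) := by
        refine Finset.sum_le_sum fun c _ => (fairBits_headNat_le q c).trans_eq ?_
        rw [ENNReal.ofReal_pow (by norm_num), ENNReal.ofReal_inv_of_pos (by norm_num)]
        simp
      _ ≤ _ := by
        rw [Finset.sum_const, nsmul_eq_mul, ← ENNReal.ofReal_natCast,
          ← ENNReal.ofReal_mul (by positivity)]
        refine ENNReal.ofReal_le_ofReal ((mul_le_mul_of_nonneg_right hcard (by positivity)).trans_eq ?_)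
        rw [inv_pow]
        field_simp
  have hlim : Tendsto (fun q : ℕ => ENNReal.ofReal (b - a + 2 * 2⁻¹ ^ q)) atTop
      (𝓝 (ENNReal.ofReal (b - a + 2 * 0))) :=
    (ENNReal.continuous_ofReal.tendsto _).comp
      (((tendsto_pow_atTop_nhds_zero_of_lt_one (by norm_num) (by norm_num)).const_mul 2).const_add _)
  simpa using ge_of_tendsto' hlim hq

/-- The value of `Δ` read off from a number `⌊N U⌋`, with `U` uniform on `[0, 1]`. -/
def uniformPick (N : ℕ) (δ : ℕ → Bool) : ℕ := segment N (min ⌊N * bitsReal δ⌋₊ (N - 1))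

theorem measurable_uniformPick (N : ℕ) : Measurable (uniformPick N) :=
  (measurable_of_countable fun t : ℕ => segment N (min t (N - 1))).comp
    (Nat.measurable_floor.comp (measurable_bitsReal.const_mul _))

theorem testBit_uniformPick {N : ℕ} (hN : N ≠ 0) (δ : ℕ → Bool) :
    N.testBit (uniformPick N δ) = true := by
  obtain ⟨d, r, hd, hr, h⟩ := exists_segment (N := N) (τ := min ⌊N * bitsReal δ⌋₊ (N - 1)) (by omega)
  rw [uniformPick, h, segment_eq hd hr]
  exact hd

theorem law_uniformPick_le {N : ℕ} (hN : N ≠ 0) (d : ℕ) :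
    fairBits {δ | uniformPick N δ = d} ≤ ((N.testBit d).toNat : ℝ≥0∞) * 2 ^ d / N := by
  have hN' : (0 : ℝ) < N := by exact_mod_cast Nat.pos_of_ne_zero hN
  cases hb : N.testBit d with
  | false =>
    have : {δ | uniformPick N δ = d} = ∅ := by
      ext δ
      simp only [Set.mem_ofPred_eq, Set.mem_empty_iff_false, iff_false]
      rintro rfl
      simp [testBit_uniformPick hN] at hb
    simp [this]
  | true =>
    have hle : topPart N (d + 1) + 2 ^ d ≤ N := by
      have := topPart_add_lt hb (r := 2 ^ d - 1) (by have := Nat.two_pow_pos d; omega)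
      omega
    calc fairBits {δ | uniformPick N δ = d}
        ≤ fairBits {δ | (topPart N (d + 1) : ℝ) / N ≤ bitsReal δ ∧
            bitsReal δ ≤ (topPart N (d + 1) + 2 ^ d : ℝ) / N} := by
          refine measure_mono fun δ hδ => ?_
          obtain ⟨e, r, he, hr, h⟩ :=
            exists_segment (N := N) (τ := min ⌊N * bitsReal δ⌋₊ (N - 1)) (by omega)
          rw [Set.mem_ofPred_eq, uniformPick, h, segment_eq he hr] at hδ
          subst hδ
          have h0 : 0 ≤ bitsReal δ := Real.ofDigits_nonneg _
          have h1 : bitsReal δ ≤ 1 := Real.ofDigits_le_one _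
          have h2 : (⌊N * bitsReal δ⌋₊ : ℝ) ≤ N * bitsReal δ := Nat.floor_le (by positivity)
          constructor
          · rw [div_le_iff₀ hN', mul_comm]
            refine le_trans ?_ h2
            exact_mod_cast (by omega : topPart N (e + 1) ≤ ⌊N * bitsReal δ⌋₊)
          · rw [le_div_iff₀ hN', mul_comm]
            by_cases hc : ⌊N * bitsReal δ⌋₊ ≤ N - 1
            · refine (Nat.lt_floor_add_one _).le.trans ?_
              exact_mod_cast (by omega : ⌊N * bitsReal δ⌋₊ + 1 ≤ topPart N (e + 1) + 2 ^ e)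
            · have h3 : (N : ℝ) ≤ topPart N (e + 1) + 2 ^ e := by
                exact_mod_cast (by omega : N ≤ topPart N (e + 1) + 2 ^ e)
              nlinarith
      _ ≤ ENNReal.ofReal ((topPart N (d + 1) + 2 ^ d : ℝ) / N - (topPart N (d + 1) : ℝ) / N) :=
          fairBits_bitsReal_le (by positivity) (by gcongr; simp)
      _ = _ := by
          rw [← sub_div, add_sub_cancel_left, ENNReal.ofReal_div_of_pos hN',
            ENNReal.ofReal_pow (by norm_num)]
          simp

theorem law_uniformPick {N : ℕ} (hN : N ≠ 0) (d : ℕ) :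
    fairBits {δ | uniformPick N δ = d} = ((N.testBit d).toNat : ℝ≥0∞) * 2 ^ d / N := by
  by_cases hd : d ≤ Nat.log 2 N
  · have hsum1 : ∑ e ∈ Finset.Icc 0 (Nat.log 2 N), fairBits {δ | uniformPick N δ = e} = 1 := by
      have := sum_measure_preimage_singleton (μ := fairBits) (f := uniformPick N)
        (Finset.Icc 0 (Nat.log 2 N))
        (fun y _ => measurable_uniformPick N (measurableSet_singleton y))
      refine this.trans ?_
      rw [show uniformPick N ⁻¹' (Finset.Icc 0 (Nat.log 2 N) : Finset ℕ) = Set.univ from ?_]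
      · simp
      · ext δ
        have : uniformPick N δ ≤ Nat.log 2 N := Nat.findGreatest_le _
        simpa using this
    have hsum2 : ∑ e ∈ Finset.Icc 0 (Nat.log 2 N), ((N.testBit e).toNat : ℝ≥0∞) * 2 ^ e / N = 1 := by
      simp_rw [div_eq_mul_inv]
      rw [← Finset.sum_mul]
      have h : (∑ e ∈ Finset.Icc 0 (Nat.log 2 N), ((N.testBit e).toNat : ℝ≥0∞) * 2 ^ e) = N := by
        have := topPart_zero N
        unfold topPart at this
        conv_rhs => rw [← this]
        push_cast
        rfl
      rw [h]
      exact ENNReal.mul_inv_cancel (by exact_mod_cast hN) (by simp)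
    refine le_antisymm (law_uniformPick_le hN d) ?_
    have hmem : d ∈ Finset.Icc 0 (Nat.log 2 N) := by simpa using hd
    rw [← Finset.add_sum_erase _ _ hmem] at hsum1 hsum2
    have hR : ∑ e ∈ (Finset.Icc 0 (Nat.log 2 N)).erase d, fairBits {δ | uniformPick N δ = e} ≠ ⊤ :=
      ne_top_of_le_ne_top ENNReal.one_ne_top (hsum1 ▸ le_add_self)
    refine (ENNReal.add_le_add_iff_right hR).1 ?_
    rw [hsum1, ← hsum2]
    gcongr with e _
    exact law_uniformPick_le hN e
  · have hz : N.testBit d = false :=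
      Nat.testBit_lt_two_pow (Nat.lt_pow_of_log_lt (by norm_num) (by omega))
    have := law_uniformPick_le hN d
    simp only [hz, Bool.toNat_false, Nat.cast_zero, zero_mul, ENNReal.zero_div,
      nonpos_iff_eq_zero] at this ⊢
    exact this

instance : Nonempty DeltaSampler :=
  ⟨⟨uniformPick, measurable_uniformPick, fun _ hN δ => testBit_uniformPick hN δ,
    fun _ hN d => law_uniformPick hN d⟩⟩

/-! ### The stegosystem `St^k_n(A)` -/

section System

variable {A : Type*} {n : ℕ}

/-- The encoder: with `S_u = {s_0, …, s_{N-1}}` and `d` the value of `Δ`, the first `d` secret bits,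
read as an integer `r`, are encoded by `s_τ` with `τ = ∑_{l = d+1}^{m} α_l 2^l + r`. -/
def encodeBlock (k : ℕ) (ord : ∀ S : Finset (Fin n → A), Fin S.card ≃ S) (Δ : DeltaSampler)
    (u : Fin n → A) (y δ : ℕ → Bool) : Fin n → A :=
  let S := typeClass k u
  let d := Δ.pick S.card δ
  let r := Nat.ofBits fun j : Fin d => y j
  ord S ⟨topPart S.card (d + 1) + r,
    topPart_add_lt (Δ.testBit_pick _ (typeClass_card_pos k u).ne' δ) (Nat.ofBits_lt_two_pow _)⟩

/-- The decoder: from `v` one obtains `S_v`, the number `τ` of `v` in it, then `d`, then `r`. -/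
def decodeBlock (k : ℕ) (ord : ∀ S : Finset (Fin n → A), Fin S.card ≃ S)
    (v : Fin n → A) : List Bool :=
  let S := typeClass k v
  let τ : ℕ := (ord S).symm ⟨v, self_mem_typeClass k v⟩
  let d := segment S.card τ
  let r := τ - topPart S.card (d + 1)
  (List.range d).map fun j => r.testBit j

theorem encodeBlock_mem (k : ℕ) (ord : ∀ S : Finset (Fin n → A), Fin S.card ≃ S)
    (Δ : DeltaSampler) (u : Fin n → A) (y δ : ℕ → Bool) :
    encodeBlock k ord Δ u y δ ∈ typeClass k u := Subtype.coe_prop _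

theorem decodeBlock_encodeBlock (k : ℕ) (ord : ∀ S : Finset (Fin n → A), Fin S.card ≃ S)
    (Δ : DeltaSampler) (u : Fin n → A) (y δ : ℕ → Bool) :
    decodeBlock k ord (encodeBlock k ord Δ u y δ) =
      (List.range (Δ.pick (typeClass k u).card δ)).map y := by
  have key : ∀ (S : Finset (Fin n → A)) (hS : S = typeClass k u)
      (hm : encodeBlock k ord Δ u y δ ∈ S),
      ((ord S).symm ⟨encodeBlock k ord Δ u y δ, hm⟩ : ℕ) =
        topPart (typeClass k u).card (Δ.pick (typeClass k u).card δ + 1) +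
          Nat.ofBits fun j : Fin (Δ.pick (typeClass k u).card δ) => y j := by
    rintro S rfl hm
    simp [encodeBlock]
  have hb := Δ.testBit_pick _ (typeClass_card_pos k u).ne' δ
  have hE := typeClass_eq (encodeBlock_mem k ord Δ u y δ)
  unfold decodeBlock
  simp only
  rw [key _ hE, hE, segment_eq hb (Nat.ofBits_lt_two_pow _)]
  refine List.map_congr_left fun j hj => ?_
  rw [Nat.add_sub_cancel_left, Nat.testBit_ofBits_lt _ _ (List.mem_range.1 hj)]

/-- The stegosystem `St^k_n(A)`, for an enumeration `ord` of every finite set of words and a way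
`Δ` to generate the random variable `Δ`. -/
def markovSystem (k : ℕ) (ord : ∀ S : Finset (Fin n → A), Fin S.card ≃ S) (Δ : DeltaSampler) :
    Stegosystem A n where
  encode := encodeBlock k ord Δ
  decode := decodeBlock k ord
  decode_encode u y δ := by simp [decodeBlock_encodeBlock]

end System

end Stego

end

open Stego

/-!
# A perfectly secure stegosystem for Markov sources of order `k`

*Security.* The probability of a prefix under a Markov source is the probability of its first `k`
letters times a product of transition probabilities over its windows of length `k + 1`. The
windows inside a block enter only through their multiset, and the windows that meet two blocks only
see the last `k` letters of one and the first `k` letters of the next; hence replacing each block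
`u` by an element of `S_u` preserves the probability (`IsMarkovSource.measure_prefixSet_eq`). On the
other hand, prescribing the transmitted blocks `v_b` prescribes the values of `Δ`, hence the
positions of the secret bits that are read, so that this event is a product of events for the
covertexts, the secret bits and the private bits (`stegoSequence_preimage_prefixSet`). Its
probability is the measure of `∏ S_{v_b}` times `∏ 2^{-d_b} · 2^{d_b} / |S_{v_b}|`, which is the
probability of `v`.

*Rate.* By stationarity the rate is `E[Δ] / n` for the first block, and
`log₂ N - 3 ≤ E[Δ] ≤ log₂ N` with `N = |S_u|` (`logb_sub_le_meanBits`, `meanBits_le`). Since a block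
is uniform on its type class given its type, `E[log₂ |S_u|]` is the entropy of a block minus the
entropy of its type (`IsMarkovSource.integral_logb_card`). The former is `(n - k) h_k` plus a
constant (`IsMarkovSource.prefixLog_add`), and the latter is at most the logarithm of the number of
types, which is `O(log n)`. No ergodicity and no estimate of `|S_u|` itself is needed.
-/

noncomputable section

namespace Stego

/-! ### Probabilities of prefixes under a Markov source -/

section Prefix

variable {A : Type*}

/-- The cylinder of the sequences that agree with `a` on the first `m` positions. -/
def prefixSet (m : ℕ) (a : ℕ → A) : Set (ℕ → A) := {x | ∀ i < m, x i = a i}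

/-- The word of length `k + 1` that starts at position `i` of the sequence `a`. -/
def window (k : ℕ) (a : ℕ → A) (i : ℕ) : Fin (k + 1) → A := fun j => a (i + j)

/-- The probability `μ(s_k | s_0 … s_{k-1})` that a context of length `k` is followed by a given
letter, both being packed into the word `s` of length `k + 1`. -/
def transProb [MeasurableSpace A] (k : ℕ) (μ : Measure (ℕ → A)) (s : Fin (k + 1) → A) : ℝ≥0∞ :=
  μ[{x | x k = s (Fin.last k)} | {x | ∀ i : Fin k, x i = s i.castSucc}]

theorem prefixSet_congr {m : ℕ} {a b : ℕ → A} (h : ∀ i < m, a i = b i) :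
    prefixSet m a = prefixSet m b := by
  ext x
  exact forall₂_congr fun i hi => by rw [h i hi]

theorem measurableSet_prefixSet [MeasurableSpace A] [MeasurableSingletonClass A] (m : ℕ)
    (a : ℕ → A) : MeasurableSet (prefixSet m a) := by
  simp only [prefixSet, Set.ofPred_forall]
  refine .iInter fun i => .iInter fun _ => ?_
  exact (measurableSet_singleton (a i)).preimage (measurable_pi_apply i)

theorem prefixSet_mul (n B : ℕ) (a : ℕ → A) :
    prefixSet (n * B) a = {x | ∀ b < B, block n x b = block n a b} := by
  ext x
  constructor
  · intro h b hb
    funext t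
    refine h _ ?_
    calc n * b + t < n * b + n := by omega
      _ = n * (b + 1) := by ring
      _ ≤ n * B := Nat.mul_le_mul_left _ hb
  · intro h i hi
    have hn : 0 < n := Nat.pos_of_ne_zero fun h0 => by simp [h0] at hi
    have := congrFun (h (i / n) (Nat.div_lt_of_lt_mul hi)) ⟨i % n, Nat.mod_lt i hn⟩
    simpa only [block, Nat.div_add_mod] using this

theorem occ_block [DecidableEq A] (k n : ℕ) (a : ℕ → A) (b : ℕ) (s : Fin (k + 1) → A) :
    occ k (block n a b) s =
      ((Finset.range (n - k)).filter fun i => window k a (n * b + i) = s).card := by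
  rw [occ, ← Set.ncard_coe_finset]
  congr 1
  ext i
  simp only [block, window, Finset.coe_filter, Finset.mem_range, Set.mem_ofPred_eq, funext_iff,
    ← add_assoc]
  exact ⟨fun ⟨h, h'⟩ => ⟨by omega, h'⟩, fun ⟨h, h'⟩ => ⟨by omega, h'⟩⟩

/-- Only the multiset of the `(k + 1)`-letter subwords of a block enters into a product over its
windows, and `S_u` fixes that multiset. -/
theorem prod_window_eq {M : Type*} [CommMonoid M] {k n : ℕ} {a a' : ℕ → A} {b : ℕ}
    (h : ∀ s, occ k (block n a' b) s = occ k (block n a b) s) (f : (Fin (k + 1) → A) → M) :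
    ∏ i ∈ Finset.range (n - k), f (window k a' (n * b + i)) =
      ∏ i ∈ Finset.range (n - k), f (window k a (n * b + i)) := by
  classical
  have key : (Finset.range (n - k)).val.map (fun i => window k a' (n * b + i)) =
      (Finset.range (n - k)).val.map (fun i => window k a (n * b + i)) := by
    ext s
    have := h s
    rw [occ_block, occ_block, Finset.card_def, Finset.card_def, Finset.filter_val,
      Finset.filter_val] at this
    rw [Multiset.count_map, Multiset.count_map]
    simpa only [eq_comm] using this
  have := congrArg (fun m => (m.map f).prod) key
  simp only [Multiset.map_map, Function.comp_def] at this
  exact this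

variable [MeasurableSpace A] {k : ℕ} {μ : Measure (ℕ → A)}

theorem IsMarkovSource.measure_prefixSet_succ [MeasurableSingletonClass A] [IsFiniteMeasure μ]
    (hμ : IsMarkovSource k μ) {m : ℕ} (hm : k ≤ m) (a : ℕ → A) :
    μ (prefixSet (m + 1) a) = μ (prefixSet m a) * transProb k μ (window k a (m - k)) := by
  have hsub : prefixSet (m + 1) a = prefixSet m a ∩ {x | x m = a m} := by
    ext x
    simp only [prefixSet, Set.mem_ofPred_eq, Set.mem_inter_iff, Nat.lt_succ_iff_lt_or_eq]
    exact ⟨fun h => ⟨fun i hi => h i (Or.inl hi), h m (Or.inr rfl)⟩,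
      fun h i hi => hi.elim (h.1 i) fun hi => hi ▸ h.2⟩
  by_cases h0 : μ (prefixSet m a) = 0
  · rw [h0, zero_mul]
    exact measure_mono_null (hsub ▸ Set.inter_subset_left) h0
  · rw [hsub, ← cond_mul_eq_inter (measurableSet_prefixSet m a), mul_comm]
    congr 1
    rw [prefixSet, hμ m hm a (a m) h0, transProb]
    have h1 : window k a (m - k) (Fin.last k) = a m := by simp [window, hm]
    have h2 : {x : ℕ → A | ∀ i < k, x i = a (m - k + i)} =
        {x | ∀ i : Fin k, x i = window k a (m - k) i.castSucc} := by
      ext x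
      simp [window, Fin.forall_iff]
    rw [h1, h2]

theorem IsMarkovSource.measure_prefixSet_add [MeasurableSingletonClass A] [IsFiniteMeasure μ]
    (hμ : IsMarkovSource k μ) {m : ℕ} (hm : k ≤ m) (r : ℕ) (a : ℕ → A) :
    μ (prefixSet (m + r) a) =
      μ (prefixSet m a) * ∏ i ∈ Finset.range r, transProb k μ (window k a (m - k + i)) := by
  induction r with
  | zero => simp
  | succ r ih =>
    rw [← add_assoc, hμ.measure_prefixSet_succ (by omega), ih, Finset.prod_range_succ, mul_assoc,
      Nat.sub_add_comm hm]

/-- Replacing every block `u` by an element of `S_u` does not change the probability of a prefix: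
the windows inside a block are permuted, and the windows across two blocks only see the last `k`
symbols of the first block and the first `k` symbols of the second. -/
theorem IsMarkovSource.measure_prefixSet_eq [MeasurableSingletonClass A] [IsFiniteMeasure μ]
    (hμ : IsMarkovSource k μ) {n : ℕ} (hn : k ≤ n) {a a' : ℕ → A} {B : ℕ}
    (h : ∀ b < B, block n a' b ∈ typeSet k (block n a b)) :
    μ (prefixSet (n * B) a') = μ (prefixSet (n * B) a) := by
  have hend : ∀ b < B, ∀ t < n, t < k ∨ n ≤ t + k → a' (n * b + t) = a (n * b + t) :=
    fun b hb t ht hk => (h b hb).2 ⟨t, ht⟩ hk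
  induction B with
  | zero => simp [prefixSet]
  | succ B ih =>
    specialize ih (fun b hb => h b (by omega)) (fun b hb => hend b (by omega))
    have hin := prod_window_eq (h B (by omega)).1 (transProb k μ)
    rcases Nat.eq_zero_or_pos B with rfl | hB
    · have hk : n * (0 + 1) = k + (n - k) := by omega
      rw [hk, hμ.measure_prefixSet_add le_rfl, hμ.measure_prefixSet_add le_rfl,
        prefixSet_congr (a := a') (b := a) fun i hi => by
          simpa using hend 0 (by omega) i (by omega) (Or.inl hi)]
      simpa using congrArg (μ (prefixSet k a) * ·) hin
    · have hnB : n ≤ n * B := Nat.le_mul_of_pos_right n hB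
      have hr : n = k + (n - k) := by omega
      rw [mul_add, mul_one, hμ.measure_prefixSet_add (hn.trans hnB),
        hμ.measure_prefixSet_add (hn.trans hnB), ih]
      congr 1
      conv_lhs => rw [hr]
      conv_rhs => rw [hr]
      rw [Finset.prod_range_add, Finset.prod_range_add, ← hr]
      congr 1
      · refine Finset.prod_congr rfl fun i hi => ?_
        have hi := Finset.mem_range.1 hi
        congr 1
        funext j
        have hj := j.2
        obtain ⟨C, rfl⟩ : ∃ C, B = C + 1 := ⟨B - 1, by omega⟩
        simp only [window]
        by_cases hc : i + j < k
        · have := hend C (by omega) (n - k + (i + j)) (by omega) (Or.inr (by omega))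
          rwa [show n * C + (n - k + (i + j)) = n * (C + 1) - k + i + j by
            rw [mul_add, mul_one]; omega] at this
        · have := hend (C + 1) (by omega) (i + j - k) (by omega) (Or.inl (by omega))
          rwa [show n * (C + 1) + (i + j - k) = n * (C + 1) - k + i + j by omega] at this
      · have he : ∀ i, n * B - k + (k + i) = n * B + i := fun i => by omega
        simpa only [he] using hin

end Prefix

/-! ### Encoding and decoding of one block -/

section Block

variable {A : Type*} {n k : ℕ}

theorem mem_typeClass {u v : Fin n → A} : v ∈ typeClass k u ↔ v ∈ typeSet k u := by
  simp [typeClass]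

theorem mem_typeClass_comm {u v : Fin n → A} : v ∈ typeClass k u ↔ u ∈ typeClass k v :=
  ⟨fun h => typeClass_eq h ▸ self_mem_typeClass k u,
    fun h => typeClass_eq h ▸ self_mem_typeClass k v⟩

variable (ord : ∀ S : Finset (Fin n → A), Fin S.card ≃ S)

theorem testBit_length_decodeBlock (v : Fin n → A) :
    (typeClass k v).card.testBit (decodeBlock k ord v).length = true := by
  obtain ⟨d, r, hd, hr, h⟩ :=
    exists_segment ((ord (typeClass k v)).symm ⟨v, self_mem_typeClass k v⟩).2
  simp only [decodeBlock, h, segment_eq hd hr, List.length_map, List.length_range, hd]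

/-- The word `v` is transmitted in place of `u` exactly when it lies in `S_u`, the value of `Δ` is
the one to which `v` belongs, and the next secret bits are those that `v` stands for. -/
theorem encodeBlock_eq_iff (Δ : DeltaSampler) (u v : Fin n → A) (y δ : ℕ → Bool) :
    encodeBlock k ord Δ u y δ = v ↔ v ∈ typeClass k u ∧
      Δ.pick (typeClass k v).card δ = (decodeBlock k ord v).length ∧
      (List.range (decodeBlock k ord v).length).map y = decodeBlock k ord v := by
  constructor
  · rintro rfl
    rw [typeClass_eq (encodeBlock_mem k ord Δ u y δ), decodeBlock_encodeBlock]
    simpa using encodeBlock_mem k ord Δ u y δ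
  · rintro ⟨hv, hp, hy⟩
    obtain ⟨d, r, hd, hr, h⟩ :=
      exists_segment ((ord (typeClass k v)).symm ⟨v, self_mem_typeClass k v⟩).2
    have hdec : decodeBlock k ord v = (List.range d).map fun j => r.testBit j := by
      simp only [decodeBlock, h, segment_eq hd hr, Nat.add_sub_cancel_left]
    rw [hdec] at hp hy
    simp only [List.length_map, List.length_range, List.map_inj_left, List.mem_range] at hp hy
    have hS := typeClass_eq hv
    have hbits : Nat.ofBits (fun j : Fin d => y j) = r := by
      refine Nat.eq_of_testBit_eq fun i => ?_
      by_cases hi : i < d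
      · rw [Nat.testBit_ofBits_lt _ _ hi, hy i hi]
      · rw [Nat.testBit_ofBits_ge _ _ (by omega), Nat.testBit_lt_two_pow
          (hr.trans_le (Nat.pow_le_pow_right (by norm_num) (by omega)))]
    have hτ : ∀ p : ℕ, p = d → topPart (typeClass k v).card (p + 1) +
        Nat.ofBits (fun j : Fin p => y j) =
        (ord (typeClass k v)).symm ⟨v, self_mem_typeClass k v⟩ := by
      rintro p rfl
      rw [hbits, h]
    have key : ∀ S : Finset (Fin n → A), S = typeClass k v →
        ∀ ht : topPart S.card (Δ.pick S.card δ + 1) +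
          Nat.ofBits (fun j : Fin (Δ.pick S.card δ) => y j) < S.card,
        (ord S ⟨_, ht⟩ : Fin n → A) = v := by
      rintro _ rfl ht
      simp [hτ _ hp]
    exact key _ hS.symm _

end Block

/-! ### Words of fair bits -/

theorem range_map_eq_set_pi (l : List Bool) :
    {y : ℕ → Bool | (List.range l.length).map y = l} =
      Set.pi (Finset.range l.length : Finset ℕ) fun i => {l.getD i false} := by
  ext y
  simp only [Set.mem_ofPred_eq, Set.mem_pi, Finset.coe_range, Set.mem_Iio, Set.mem_singleton_iff]
  constructor
  · intro h i hi
    conv_rhs => rw [← h]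
    simp [hi]
  · intro h
    refine List.ext_getElem (by simp) fun i h1 h2 => ?_
    simpa [h2] using h i h2

theorem measurableSet_range_map (l : List Bool) :
    MeasurableSet {y : ℕ → Bool | (List.range l.length).map y = l} := by
  rw [range_map_eq_set_pi]
  exact .pi (Finset.countable_toSet _) fun i _ => measurableSet_singleton _

theorem fairBits_range_map (l : List Bool) :
    fairBits {y | (List.range l.length).map y = l} = 2⁻¹ ^ l.length := by
  rw [range_map_eq_set_pi, fairBits, Measure.infinitePi_pi _ fun i _ => measurableSet_singleton _]
  simp

/-- Consecutive words read off a sequence are the prescribed ones exactly when the corresponding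
initial segment is their concatenation. -/
theorem forall_range_map_iff (w : ℕ → List Bool) (y : ℕ → Bool) (B : ℕ) :
    (∀ b < B, (List.range (w b).length).map
        (fun j => y (∑ c ∈ Finset.range b, (w c).length + j)) = w b) ↔
      (List.range (∑ c ∈ Finset.range B, (w c).length)).map y = (List.range B).flatMap w := by
  induction B with
  | zero => simp
  | succ B ih =>
    rw [Nat.forall_lt_succ_right, ih, Finset.sum_range_succ, List.range_add, List.map_append,
      List.range_succ, List.flatMap_append, List.map_map]
    simp only [List.flatMap_cons, List.flatMap_nil, List.append_nil, Function.comp_def]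
    refine ⟨fun h => by rw [h.1, h.2], fun h => List.append_inj' h (by simp)⟩

theorem fairBits_words (w : ℕ → List Bool) (B : ℕ) :
    fairBits {y | ∀ b < B, (List.range (w b).length).map
        (fun j => y (∑ c ∈ Finset.range b, (w c).length + j)) = w b} =
      ∏ b ∈ Finset.range B, 2⁻¹ ^ (w b).length := by
  have hl : ((List.range B).flatMap w).length = ∑ c ∈ Finset.range B, (w c).length := by
    induction B with
    | zero => simp
    | succ B ih => rw [List.range_succ, List.flatMap_append, List.length_append, ih,
        Finset.sum_range_succ]; simp
  simp only [forall_range_map_iff]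
  rw [← hl, fairBits_range_map, hl, Finset.prod_pow_eq_pow_sum]

/-- The subsequences of the private bits assigned to the blocks are independent sequences of fair
bits. -/
theorem measurePreserving_pair : MeasurePreserving (fun (δ : ℕ → Bool) b j => δ (Nat.pair b j))
    fairBits (Measure.infinitePi fun _ : ℕ => fairBits) := by
  have hm : Measurable fun (δ : ℕ → Bool) (b j : ℕ) => δ (Nat.pair b j) := by fun_prop
  refine ⟨hm, ?_⟩
  have h1 := Measure.infinitePi_map_piCongrLeft
    (fun _ : ℕ × ℕ => (PMF.uniformOfFintype Bool).toMeasure) Nat.pairEquiv.symm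
  have h2 := Measure.infinitePi_map_curry
    (fun _ _ : ℕ => (PMF.uniformOfFintype Bool).toMeasure)
  change _ = Measure.infinitePi fun _ : ℕ => Measure.infinitePi _
  rw [← h2, ← h1, Measure.map_map (by fun_prop) (by fun_prop)]
  rw [fairBits]
  congr 1
  funext δ b j
  have h := MeasurableEquiv.piCongrLeft_apply_apply (β := fun _ : ℕ × ℕ => Bool)
    Nat.pairEquiv.symm δ (Nat.pair b j)
  rw [show Nat.pairEquiv.symm (Nat.pair b j) = (b, j) from Nat.unpair_pair b j] at h
  exact h.symm

theorem measurePreserving_subsequence (b : ℕ) :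
    MeasurePreserving (fun (δ : ℕ → Bool) j => δ (Nat.pair b j)) fairBits fairBits :=
  (measurePreserving_eval_infinitePi (fun _ : ℕ => fairBits) b).comp measurePreserving_pair

theorem fairBits_pick (Δ : DeltaSampler) {N e : ℕ → ℕ} {B : ℕ} (hN : ∀ b < B, N b ≠ 0)
    (he : ∀ b < B, (N b).testBit (e b) = true) :
    fairBits {δ | ∀ b < B, Δ.pick (N b) (fun j => δ (Nat.pair b j)) = e b} =
      ∏ b ∈ Finset.range B, (2 ^ e b / N b : ℝ≥0∞) := by
  have hm : ∀ b, MeasurableSet {δ | Δ.pick (N b) δ = e b} := fun b =>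
    Δ.measurable_pick _ (measurableSet_singleton _)
  have h := measurePreserving_pair.measure_preimage
    (s := Set.pi (Finset.range B : Finset ℕ) fun b => {δ | Δ.pick (N b) δ = e b})
    (MeasurableSet.pi (Finset.countable_toSet _) fun b _ => hm b).nullMeasurableSet
  rw [Measure.infinitePi_pi _ fun b _ => hm b] at h
  refine (congrArg fairBits ?_).trans (h.trans (Finset.prod_congr rfl fun b hb => ?_))
  · ext δ
    simp
  · have hb := Finset.mem_range.1 hb
    rw [Δ.law_pick _ (hN b hb), he b hb]
    simp

/-! ### The law of the transmitted sequence -/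

namespace Stegosystem

variable {A : Type*} {n : ℕ}

theorem block_stegoSequence (S : Stegosystem A n) (hn : 0 < n) (ω : Outcome A) (b : ℕ) :
    block n (S.stegoSequence hn ω) b = S.sendBlock ω b (S.hiddenBits ω b) := by
  funext t
  have h1 : (n * b + t) / n = b := by
    rw [Nat.mul_add_div hn, Nat.div_eq_of_lt t.2, add_zero]
  have h2 : (⟨(n * b + t) % n, Nat.mod_lt _ hn⟩ : Fin n) = t :=
    Fin.ext (by simp [Nat.mod_eq_of_lt t.2])
  simp only [block, stegoSequence, h1, h2]

/-- Once the transmitted blocks are prescribed, so are the positions at which the secret bits are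
read. -/
theorem forall_sendBlock_eq_iff (S : Stegosystem A n) (ω : Outcome A) (w : ℕ → Fin n → A) (B : ℕ) :
    (∀ b < B, S.sendBlock ω b (S.hiddenBits ω b) = w b) ↔
      ∀ b < B, S.sendBlock ω b (∑ c ∈ Finset.range b, (S.decode (w c)).length) = w b := by
  suffices h : ((∀ b < B, S.sendBlock ω b (S.hiddenBits ω b) = w b) ↔
      ∀ b < B, S.sendBlock ω b (∑ c ∈ Finset.range b, (S.decode (w c)).length) = w b) ∧
      ((∀ b < B, S.sendBlock ω b (S.hiddenBits ω b) = w b) →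
        S.hiddenBits ω B = ∑ c ∈ Finset.range B, (S.decode (w c)).length) from h.1
  induction B with
  | zero => simp [hiddenBits]
  | succ B ih =>
    simp only [Nat.forall_lt_succ_right]
    constructor
    · rw [← ih.1]
      exact and_congr_right fun h => by rw [ih.2 h]
    · rintro ⟨h1, h2⟩
      rw [hiddenBits, Finset.sum_range_succ, h2, ih.2 h1]

end Stegosystem

/-- Two probability measures on sequences that agree on all prefixes consisting of whole blocks are
equal. -/
theorem measure_ext_of_prefixSet {A : Type*} [Countable A] [MeasurableSpace A]
    [DiscreteMeasurableSpace A] {μ ν : Measure (ℕ → A)} [IsProbabilityMeasure μ]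
    [IsProbabilityMeasure ν] {n : ℕ} (hn : 0 < n)
    (h : ∀ B a, μ (prefixSet (n * B) a) = ν (prefixSet (n * B) a)) : μ = ν := by
  obtain ⟨x₀⟩ : Nonempty (ℕ → A) := nonempty_of_isProbabilityMeasure μ
  refine IsProjectiveLimit.unique (P := fun I : Finset ℕ => μ.map I.restrict) (fun I => rfl)
    fun I => ?_
  obtain ⟨B, hB⟩ : ∃ B, ∀ i ∈ I, i < n * B :=
    ⟨I.sup id + 1, fun i hi => (Nat.lt_succ_of_le (Finset.le_sup (f := id) hi)).trans_le
      (Nat.le_mul_of_pos_left _ hn)⟩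
  have hr : Measurable fun (x : ℕ → A) (i : Fin (n * B)) => x i := by fun_prop
  have hmap : μ.map (fun (x : ℕ → A) (i : Fin (n * B)) => x i) =
      ν.map (fun (x : ℕ → A) (i : Fin (n * B)) => x i) := by
    refine Measure.ext_of_singleton fun u => ?_
    rw [Measure.map_apply hr (measurableSet_singleton u),
      Measure.map_apply hr (measurableSet_singleton u)]
    convert! h B fun i => if hi : i < n * B then u ⟨i, hi⟩ else x₀ i using 2 <;>
    · ext x
      simp +contextual [prefixSet, funext_iff, Fin.forall_iff]
  have hcomp : (I.restrict : (ℕ → A) → _) =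
      (fun (u : Fin (n * B) → A) (i : I) => u ⟨i, hB i i.2⟩) ∘
        fun (x : ℕ → A) (i : Fin (n * B)) => x i := rfl
  change ν.map I.restrict = μ.map I.restrict
  rw [hcomp, ← Measure.map_map (by fun_prop) hr, ← Measure.map_map (by fun_prop) hr, hmap]

theorem measurable_block {A : Type*} [MeasurableSpace A] (n b : ℕ) :
    Measurable fun x : ℕ → A => block n x b := by
  unfold block
  fun_prop

/-- The event that given blocks are transmitted is a product event: a condition on the covertexts,
a condition on the secret bits and a condition on the private bits. -/
theorem stegoSequence_preimage_prefixSet {A : Type*} {n k : ℕ}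
    (ord : ∀ S : Finset (Fin n → A), Fin S.card ≃ S) (Δ : DeltaSampler) (hn : 0 < n) (B : ℕ)
    (v : ℕ → A) :
    (markovSystem k ord Δ).stegoSequence hn ⁻¹' prefixSet (n * B) v =
      {x : ℕ → A | ∀ b < B, block n v b ∈ typeClass k (block n x b)} ×ˢ
        ({y | ∀ b < B, (List.range (decodeBlock k ord (block n v b)).length).map
          (fun j => y (∑ c ∈ Finset.range b, (decodeBlock k ord (block n v c)).length + j)) =
            decodeBlock k ord (block n v b)} ×ˢ
        {δ | ∀ b < B, Δ.pick (typeClass k (block n v b)).card (fun j => δ (Nat.pair b j)) =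
          (decodeBlock k ord (block n v b)).length}) := by
  ext ω
  rw [Set.mem_preimage, prefixSet_mul, Set.mem_ofPred_eq]
  simp only [Stegosystem.block_stegoSequence]
  rw [Stegosystem.forall_sendBlock_eq_iff]
  simp only [Stegosystem.sendBlock, markovSystem, encodeBlock_eq_iff, Set.mem_prod,
    Set.mem_ofPred_eq, forall_and]
  tauto

section Security

variable {A : Type*} [Countable A] [MeasurableSpace A] [DiscreteMeasurableSpace A] {n k : ℕ}

/-- The sequences whose blocks have the types of the blocks of `v` form a disjoint union of
cylinders, all as probable as that of `v`. -/
theorem IsMarkovSource.measure_forall_mem_typeClass {μ : Measure (ℕ → A)} [IsFiniteMeasure μ]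
    (hμ : IsMarkovSource k μ) (hn : k ≤ n) (B : ℕ) (v : ℕ → A) :
    μ {x | ∀ b < B, block n v b ∈ typeClass k (block n x b)} =
      (∏ b ∈ Finset.range B, ((typeClass k (block n v b)).card : ℝ≥0∞)) *
        μ (prefixSet (n * B) v) := by
  have hX : {x : ℕ → A | ∀ b < B, block n v b ∈ typeClass k (block n x b)} =
      ⋃ w ∈ Fintype.piFinset fun b : Fin B => typeClass k (block n v b),
        (fun (x : ℕ → A) (b : Fin B) => block n x b) ⁻¹' {w} := by
    ext x
    simp [mem_typeClass_comm (v := block n v _), Fin.forall_iff]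
  have hm : Measurable fun (x : ℕ → A) (b : Fin B) => block n x b :=
    measurable_pi_lambda _ fun b => measurable_block n b
  rw [hX, measure_biUnion_finset
    (fun w _ w' _ hw => Disjoint.preimage _ (Set.disjoint_singleton.2 hw))
    fun w _ => hm (measurableSet_singleton w)]
  have hc : ∀ w ∈ Fintype.piFinset fun b : Fin B => typeClass k (block n v b),
      μ ((fun (x : ℕ → A) (b : Fin B) => block n x b) ⁻¹' {w}) = μ (prefixSet (n * B) v) := by
    intro w hw
    obtain ⟨a, ha⟩ : ∃ a : ℕ → A, ∀ b : Fin B, block n a b = w b := by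
      refine ⟨fun i => if h : i / n < B ∧ 0 < n then w ⟨i / n, h.1⟩ ⟨i % n, Nat.mod_lt _ h.2⟩
        else v i, fun b => funext fun t => ?_⟩
      have hn : 0 < n := t.pos
      have h1 : (n * b + t) / n = b := by
        rw [Nat.mul_add_div hn, Nat.div_eq_of_lt t.2, add_zero]
      have h2 : (n * b + t) % n = t := by simp [Nat.mod_eq_of_lt t.2]
      simp only [block, h1, h2, b.2, hn, and_self, dif_pos]
    rw [← hμ.measure_prefixSet_eq hn (a' := a) (a := v) (B := B) fun b hb => ?_, prefixSet_mul]
    · congr 1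
      ext x
      simp [funext_iff (f := fun b : Fin B => block n x b), ← ha, Fin.forall_iff]
    · rw [ha ⟨b, hb⟩, ← mem_typeClass]
      exact Fintype.mem_piFinset.1 hw ⟨b, hb⟩
  rw [Finset.sum_congr rfl hc, Finset.sum_const, nsmul_eq_mul, Fintype.card_piFinset,
    Fin.prod_univ_eq_prod_range (fun b => (typeClass k (block n v b)).card) B, Nat.cast_prod]

variable (ord : ∀ S : Finset (Fin n → A), Fin S.card ≃ S) (Δ : DeltaSampler)

theorem measurableSet_stegoSequence_preimage (hn : 0 < n) (B : ℕ) (v : ℕ → A) :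
    MeasurableSet ((markovSystem k ord Δ).stegoSequence hn ⁻¹' prefixSet (n * B) v) := by
  rw [stegoSequence_preimage_prefixSet]
  refine .prod ?_ (.prod ?_ ?_)
  · simp only [Set.ofPred_forall]
    exact .iInter fun b => .iInter fun _ => measurable_block n b (Set.to_countable
      {u | block n v b ∈ typeClass k u}).measurableSet
  · simp only [Set.ofPred_forall]
    refine .iInter fun b => .iInter fun _ => ?_
    exact (measurableSet_range_map _).preimage (by fun_prop : Measurable fun (y : ℕ → Bool) j =>
      y (∑ c ∈ Finset.range b, (decodeBlock k ord (block n v c)).length + j))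
  · simp only [Set.ofPred_forall]
    refine .iInter fun b => .iInter fun _ => ?_
    exact ((Δ.measurable_pick _).comp (by fun_prop : Measurable fun (δ : ℕ → Bool) j =>
      δ (Nat.pair b j))) (measurableSet_singleton _)

theorem measurable_stegoSequence (hn : 0 < n) :
    Measurable ((markovSystem k ord Δ).stegoSequence hn) := by
  refine measurable_pi_lambda _ fun i => ?_
  have h : Measurable fun ω (j : Fin (n * (i + 1))) =>
      (markovSystem k ord Δ).stegoSequence hn ω j := by
    refine measurable_to_countable' fun u => ?_
    rcases Set.eq_empty_or_nonempty ((fun ω (j : Fin (n * (i + 1))) =>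
      (markovSystem k ord Δ).stegoSequence hn ω j) ⁻¹' {u}) with h0 | ⟨ω₀, h0⟩
    · rw [h0]
      exact .empty
    · convert measurableSet_stegoSequence_preimage (k := k) ord Δ hn (i + 1)
        ((markovSystem k ord Δ).stegoSequence hn ω₀)
      obtain rfl := h0
      ext ω
      simp [prefixSet, funext_iff, Fin.forall_iff]
  exact (measurable_pi_apply (⟨i, (Nat.lt_succ_self i).trans_le (Nat.le_mul_of_pos_left _ hn)⟩ :
    Fin (n * (i + 1)))).comp h

instance (μ : Measure (ℕ → A)) [IsProbabilityMeasure μ] :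
    IsProbabilityMeasure (protocolMeasure μ) := by
  unfold protocolMeasure
  infer_instance

/-- Given the covertexts, the transmitted blocks are independent and uniform on their type classes;
since the blocks of a class are equally probable, the law of the covertexts is reproduced. -/
theorem IsMarkovSource.protocolMeasure_preimage_prefixSet {μ : Measure (ℕ → A)}
    [IsProbabilityMeasure μ] (hμ : IsMarkovSource k μ) (hk : k ≤ n) (hn : 0 < n) (B : ℕ)
    (v : ℕ → A) :
    protocolMeasure μ ((markovSystem k ord Δ).stegoSequence hn ⁻¹' prefixSet (n * B) v) =
      μ (prefixSet (n * B) v) := by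
  rw [stegoSequence_preimage_prefixSet, protocolMeasure, Measure.prod_prod, Measure.prod_prod,
    hμ.measure_forall_mem_typeClass hk,
    fairBits_words (fun b => decodeBlock k ord (block n v b)),
    fairBits_pick Δ (N := fun b => (typeClass k (block n v b)).card)
      (fun b _ => (typeClass_card_pos k _).ne') fun b _ => testBit_length_decodeBlock ord _,
    mul_right_comm, ← Finset.prod_mul_distrib, ← Finset.prod_mul_distrib]
  refine (congrArg (· * _) (Finset.prod_eq_one fun b _ => ?_)).trans (one_mul _)
  have hN : ((typeClass k (block n v b)).card : ℝ≥0∞) ≠ 0 := by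
    exact_mod_cast (typeClass_card_pos k _).ne'
  rw [div_eq_mul_inv, ← ENNReal.inv_pow, ← mul_assoc (_⁻¹),
    ENNReal.inv_mul_cancel (by simp) (by simp), one_mul, ENNReal.mul_inv_cancel hN (by simp)]

theorem IsMarkovSource.perfectlySecure {μ : Measure (ℕ → A)} [IsProbabilityMeasure μ]
    (hμ : IsMarkovSource k μ) (hk : k ≤ n) (hn : 0 < n) :
    (markovSystem k ord Δ).PerfectlySecure hn μ := by
  have hm := measurable_stegoSequence (k := k) ord Δ hn
  refine ⟨hm.aemeasurable, measurable_fst.aemeasurable, ?_⟩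
  have hfst : (protocolMeasure μ).map (fun ω => ω.1) = μ := by
    rw [protocolMeasure]
    exact Measure.fst_prod
  have := Measure.isProbabilityMeasure_map (μ := protocolMeasure μ) hm.aemeasurable
  rw [hfst]
  refine measure_ext_of_prefixSet hn fun B a => ?_
  rw [Measure.map_apply hm (measurableSet_prefixSet _ _),
    hμ.protocolMeasure_preimage_prefixSet ord Δ hk hn]

end Security

/-! ### The expected value of `Δ` -/

/-- The expectation of `Δ` for a set of `N` words. -/
def meanBits (Δ : DeltaSampler) (N : ℕ) : ℝ := ∫ δ, (Δ.pick N δ : ℝ) ∂fairBits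

theorem DeltaSampler.pick_le_log (Δ : DeltaSampler) {N : ℕ} (hN : N ≠ 0) (δ : ℕ → Bool) :
    Δ.pick N δ ≤ Nat.log 2 N :=
  Nat.le_log_of_pow_le (by norm_num) (Nat.ge_two_pow_of_testBit (Δ.testBit_pick N hN δ))

theorem DeltaSampler.integrable_pick (Δ : DeltaSampler) {N : ℕ} (hN : N ≠ 0) :
    Integrable (fun δ => (Δ.pick N δ : ℝ)) fairBits := by
  refine Integrable.of_bound
    ((measurable_from_top (f := fun d : ℕ => (d : ℝ))).comp
      (Δ.measurable_pick N)).aestronglyMeasurable (Nat.log 2 N) (.of_forall fun δ => ?_)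
  rw [Real.norm_natCast]
  exact_mod_cast Δ.pick_le_log hN δ

theorem meanBits_le (Δ : DeltaSampler) {N : ℕ} (hN : N ≠ 0) : meanBits Δ N ≤ Real.logb 2 N := by
  calc meanBits Δ N ≤ ∫ _, Real.logb 2 N ∂fairBits := by
        refine integral_mono (Δ.integrable_pick hN) (integrable_const _) fun δ => ?_
        exact (Nat.cast_le.2 (Δ.pick_le_log hN δ)).trans (Real.natLog_le_logb N 2)
    _ = Real.logb 2 N := by simp

theorem sum_range_mul_half_pow (n : ℕ) :
    ∑ j ∈ Finset.range n, (j : ℝ) * 2⁻¹ ^ j = 2 - 2 * (n + 1) * 2⁻¹ ^ n := by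
  induction n with
  | zero => simp
  | succ n ih =>
    rw [Finset.sum_range_succ, ih, pow_succ]
    push_cast
    ring

/-- The value `m - j` is taken with probability at most `2⁻ʲ`, where `m = ⌊log₂ N⌋`; hence the
expectation of `Δ` is at least `m - 2`. -/
theorem logb_sub_le_meanBits (Δ : DeltaSampler) {N : ℕ} (hN : N ≠ 0) :
    Real.logb 2 N - 3 ≤ meanBits Δ N := by
  set m := Nat.log 2 N with hm
  have hlog : Real.logb 2 N ≤ m + 1 := by
    rw [Real.logb_le_iff_le_rpow (by norm_num) (by positivity)]
    have := (Nat.lt_pow_succ_log_self (b := 2) (by norm_num) N).le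
    rw [← hm] at this
    exact_mod_cast this
  have hmN : (2 : ℝ) ^ m ≤ N := by exact_mod_cast Nat.pow_log_le_self 2 hN
  have hsum : ∀ δ, (m : ℝ) - Δ.pick N δ = ∑ j ∈ Finset.range (m + 1),
      (Δ.pick N ⁻¹' {m - j}).indicator (fun _ => (j : ℝ)) δ := by
    intro δ
    have hle := Δ.pick_le_log hN δ
    rw [Finset.sum_eq_single_of_mem (m - Δ.pick N δ) (Finset.mem_range.2 (by omega))]
    · rw [Set.indicator_of_mem (by simp; omega), Nat.cast_sub hle]
    · intro j hj hne
      rw [Finset.mem_range] at hj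
      exact Set.indicator_of_notMem (by simp; omega) _
  have hms : ∀ j, MeasurableSet (Δ.pick N ⁻¹' {m - j}) := fun j =>
    Δ.measurable_pick N (measurableSet_singleton _)
  have hprob : ∀ j ∈ Finset.range (m + 1),
      fairBits.real (Δ.pick N ⁻¹' {m - j}) ≤ 2⁻¹ ^ j := by
    intro j hj
    have hj : j ≤ m := Nat.lt_succ_iff.1 (Finset.mem_range.1 hj)
    have h1 : fairBits (Δ.pick N ⁻¹' {m - j}) = _ := Δ.law_pick N hN (m - j)
    rw [Measure.real, h1]
    have h2 : ((N.testBit (m - j)).toNat : ℝ) ≤ 1 := by exact_mod_cast Bool.toNat_le _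
    simp only [ENNReal.toReal_div, ENNReal.toReal_mul, ENNReal.toReal_natCast, ENNReal.toReal_pow,
      ENNReal.toReal_ofNat]
    calc ((N.testBit (m - j)).toNat : ℝ) * 2 ^ (m - j) / N ≤ 1 * 2 ^ (m - j) / 2 ^ m := by gcongr
      _ = 2⁻¹ ^ j := by
        rw [pow_sub₀ _ (by norm_num) hj, inv_pow]
        field_simp
  have hkey : (m : ℝ) - meanBits Δ N ≤ 2 := by
    calc (m : ℝ) - meanBits Δ N = ∫ δ, ((m : ℝ) - Δ.pick N δ) ∂fairBits := by
          rw [integral_sub (integrable_const _) (Δ.integrable_pick hN)]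
          simp [meanBits]
      _ = ∑ j ∈ Finset.range (m + 1), fairBits.real (Δ.pick N ⁻¹' {m - j}) * j := by
          simp_rw [hsum]
          rw [integral_finsetSum _ fun j _ => (integrable_const _).indicator (hms j)]
          refine Finset.sum_congr rfl fun j _ => ?_
          rw [integral_indicator_const _ (hms j), smul_eq_mul]
      _ ≤ ∑ j ∈ Finset.range (m + 1), (j : ℝ) * 2⁻¹ ^ j := by
          refine Finset.sum_le_sum fun j hj => ?_
          rw [mul_comm]
          exact mul_le_mul_of_nonneg_left (hprob j hj) (by positivity)
      _ ≤ 2 := by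
          rw [sum_range_mul_half_pow]
          have : (0 : ℝ) ≤ 2 * ((m + 1 : ℕ) + 1) * 2⁻¹ ^ (m + 1) := by positivity
          linarith
  linarith

/-! ### The expected number of hidden bits -/

section Rate

variable {A : Type*} {n k : ℕ}

theorem hiddenBits_markovSystem (ord : ∀ S : Finset (Fin n → A), Fin S.card ≃ S) (Δ : DeltaSampler)
    (ω : Outcome A) (B : ℕ) :
    (markovSystem k ord Δ).hiddenBits ω B = ∑ b ∈ Finset.range B,
      Δ.pick (typeClass k (block n ω.1 b)).card fun j => ω.2.2 (Nat.pair b j) := by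
  induction B with
  | zero => simp [Stegosystem.hiddenBits]
  | succ B ih =>
    rw [Stegosystem.hiddenBits, Finset.sum_range_succ, ih]
    simp [Stegosystem.sendBlock, markovSystem, decodeBlock_encodeBlock]

theorem measurePreserving_block_bits [MeasurableSpace A] (μ : Measure (ℕ → A))
    [IsProbabilityMeasure μ] (b : ℕ) :
    MeasurePreserving (fun ω : Outcome A => (block n ω.1 b, fun j => ω.2.2 (Nat.pair b j)))
      (protocolMeasure μ) ((μ.map fun x => block n x b).prod fairBits) :=
  ((measurable_block n b).measurePreserving μ).prod
    ((measurePreserving_subsequence b).comp measurePreserving_snd)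

variable [Finite A] [MeasurableSpace A] [DiscreteMeasurableSpace A]

theorem integrable_pick_card (Δ : DeltaSampler) (ν : Measure (Fin n → A)) [IsFiniteMeasure ν] :
    Integrable (fun q : (Fin n → A) × (ℕ → Bool) => (Δ.pick (typeClass k q.1).card q.2 : ℝ))
      (ν.prod fairBits) := by
  have hm : Measurable fun q : (Fin n → A) × (ℕ → Bool) => Δ.pick (typeClass k q.1).card q.2 :=
    measurable_from_prod_countable_right fun u => Δ.measurable_pick (typeClass k u).card
  refine Integrable.of_bound ((measurable_from_top (f := fun d : ℕ => (d : ℝ))).comp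
    hm).aestronglyMeasurable (Nat.log 2 (Nat.card (Fin n → A))) (.of_forall fun q => ?_)
  rw [Real.norm_natCast, Nat.cast_le]
  refine (Δ.pick_le_log (typeClass_card_pos k q.1).ne' _).trans (Nat.log_mono_right ?_)
  have := Fintype.ofFinite (Fin n → A)
  rw [Nat.card_eq_fintype_card]
  exact Finset.card_le_univ _

variable (μ : Measure (ℕ → A)) [IsProbabilityMeasure μ]

theorem integrable_pick_block (Δ : DeltaSampler) (b : ℕ) :
    Integrable (fun ω : Outcome A => (Δ.pick (typeClass k (block n ω.1 b)).card
      (fun j => ω.2.2 (Nat.pair b j)) : ℝ)) (protocolMeasure μ) :=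
  have := Measure.isProbabilityMeasure_map (μ := μ) (measurable_block n b).aemeasurable
  (measurePreserving_block_bits μ b).integrable_comp_of_integrable
    (integrable_pick_card (k := k) Δ _)

theorem integral_pick_block (Δ : DeltaSampler) (b : ℕ) :
    ∫ ω : Outcome A, (Δ.pick (typeClass k (block n ω.1 b)).card
      (fun j => ω.2.2 (Nat.pair b j)) : ℝ) ∂(protocolMeasure μ) =
      ∫ x, meanBits Δ (typeClass k (block n x b)).card ∂μ := by
  have := Measure.isProbabilityMeasure_map (μ := μ) (measurable_block n b).aemeasurable
  have hi := integrable_pick_card (k := k) Δ (μ.map fun x => block n x b)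
  have hp := measurePreserving_block_bits (n := n) μ b
  have h1 := integral_map hp.measurable.aemeasurable (hp.map_eq.symm ▸ hi.aestronglyMeasurable)
  rw [← h1, hp.map_eq, integral_prod _ hi]
  exact integral_map (measurable_block n b).aemeasurable
    (measurable_of_finite _).aestronglyMeasurable

theorem integrable_hiddenBits (ord : ∀ S : Finset (Fin n → A), Fin S.card ≃ S) (Δ : DeltaSampler)
    (B : ℕ) : Integrable (fun ω => ((markovSystem k ord Δ).hiddenBits ω B : ℝ))
      (protocolMeasure μ) := by
  simp only [hiddenBits_markovSystem, Nat.cast_sum]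
  exact integrable_finsetSum _ fun b _ => integrable_pick_block μ Δ b

end Rate

/-! ### Stationary sources -/

section Stationary

variable {A : Type*} [MeasurableSpace A] {μ : Measure (ℕ → A)}

theorem IsStationarySource.measurePreserving_shift (h : IsStationarySource μ) (m : ℕ) :
    MeasurePreserving (fun (x : ℕ → A) i => x (i + m)) μ μ := by
  induction m with
  | zero => exact MeasurePreserving.id μ
  | succ m ih =>
    convert ih.comp h using 1
    funext x i
    simp [add_assoc]

variable [Finite A] [DiscreteMeasurableSpace A]

theorem IsStationarySource.integral_block (h : IsStationarySource μ) {n : ℕ} (b : ℕ)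
    (f : (Fin n → A) → ℝ) : ∫ x, f (block n x b) ∂μ = ∫ x, f (block n x 0) ∂μ := by
  have hs := h.measurePreserving_shift (n * b)
  have h0 : AEStronglyMeasurable (fun x => f (block n x 0)) μ :=
    ((measurable_of_finite f).comp (measurable_block n 0)).aestronglyMeasurable
  have := integral_map hs.measurable.aemeasurable (hs.map_eq.symm ▸ h0)
  rw [hs.map_eq] at this
  rw [this]
  refine integral_congr_ae (.of_forall fun x => congrArg f ?_)
  funext t
  simp [block, add_comm]

theorem IsStationarySource.rate_eq [IsProbabilityMeasure μ] (h : IsStationarySource μ) {n k : ℕ}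
    (ord : ∀ S : Finset (Fin n → A), Fin S.card ≃ S) (Δ : DeltaSampler) {T : ℕ} (hT : 0 < T) :
    (markovSystem k ord Δ).rate μ T =
      (∫ x, meanBits Δ (typeClass k (block n x 0)).card ∂μ) / n := by
  simp only [Stegosystem.rate, hiddenBits_markovSystem, Nat.cast_sum]
  rw [integral_finsetSum _ fun b _ => integrable_pick_block μ Δ b]
  simp only [integral_pick_block]
  rw [Finset.sum_congr rfl fun b _ =>
    h.integral_block b fun u => meanBits Δ (typeClass k u).card, Finset.sum_const,
    Finset.card_range, nsmul_eq_mul, mul_comm (n : ℝ), mul_div_mul_left _ _ (by positivity)]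

end Stationary

/-! ### Entropy of a prefix -/

section Entropy

variable {A : Type*}

theorem window_shift (k : ℕ) (x : ℕ → A) (m : ℕ) :
    window k (fun i => x (i + m)) 0 = window k x m := by
  funext j
  simp [window, add_comm]

theorem measurable_window [MeasurableSpace A] (k m : ℕ) :
    Measurable fun x : ℕ → A => window k x m := by
  unfold window
  fun_prop

theorem ae_measure_prefixSet_ne_zero [Countable A] [MeasurableSpace A]
    (μ : Measure (ℕ → A)) (m : ℕ) : ∀ᵐ x ∂μ, μ (prefixSet m x) ≠ 0 := by
  let r : (ℕ → A) → Fin m → A := fun x i => x i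
  have hr : ∀ x, prefixSet m x = r ⁻¹' {r x} := fun x => by
    ext z
    simp [r, prefixSet, funext_iff, Fin.forall_iff]
  have h0 : μ (⋃ u ∈ {u | μ (r ⁻¹' {u}) = 0}, r ⁻¹' {u}) = 0 :=
    (measure_biUnion_null_iff (Set.to_countable _)).2 fun u hu => hu
  refine measure_mono_null (fun x hx => ?_) h0
  have hx : μ (prefixSet m x) = 0 := by simpa using hx
  exact Set.mem_biUnion (x := r x) (by rwa [hr] at hx) rfl

variable [MeasurableSpace A] [DiscreteMeasurableSpace A]

/-- On a finite alphabet, a function that depends on finitely many letters is integrable. -/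
theorem integrable_of_prefix [Finite A] (μ : Measure (ℕ → A)) [IsFiniteMeasure μ] (m : ℕ)
    (f : (ℕ → A) → ℝ) (hf : ∀ x z, (∀ i < m, x i = z i) → f x = f z) : Integrable f μ := by
  rcases isEmpty_or_nonempty (ℕ → A) with _ | ⟨⟨x₀⟩⟩
  · rw [Measure.eq_zero_of_isEmpty μ]
    exact integrable_zero_measure
  have hr : Measurable fun (x : ℕ → A) (i : Fin m) => x i := by fun_prop
  have := (Integrable.of_finite (μ := μ.map fun (x : ℕ → A) (i : Fin m) => x i)
    (f := fun u => f fun i => if h : i < m then u ⟨i, h⟩ else x₀ i)).comp_measurable hr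
  refine this.congr (.of_forall fun x => hf _ _ fun i hi => ?_)
  simp [hi]

/-- The expected logarithm of the probability of the first `m` letters, i.e. minus the Shannon
entropy of these letters. -/
def prefixLog (μ : Measure (ℕ → A)) (m : ℕ) : ℝ := ∫ x, Real.logb 2 (μ.real (prefixSet m x)) ∂μ

theorem integrable_logb_prefixSet [Finite A] (μ : Measure (ℕ → A)) [IsFiniteMeasure μ] (m : ℕ) :
    Integrable (fun x => Real.logb 2 (μ.real (prefixSet m x))) μ :=
  integrable_of_prefix μ m _ fun x z h => by rw [prefixSet_congr h]

/-- The conditional entropy as an expectation. -/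
theorem integral_logb_transProb [Fintype A] (k : ℕ) (μ : Measure (ℕ → A))
    [IsProbabilityMeasure μ] :
    ∫ x, Real.logb 2 (transProb k μ (window k x 0)).toReal ∂μ = -condEntropy k μ := by
  have hw := measurable_window (A := A) k 0
  have := Measure.isProbabilityMeasure_map (μ := μ) hw.aemeasurable
  rw [← integral_map (φ := fun x => window k x 0) hw.aemeasurable
    (f := fun s => Real.logb 2 (transProb k μ s).toReal)
    (measurable_of_finite _).aestronglyMeasurable, integral_fintype Integrable.of_finite,
    condEntropy, neg_neg, ← (Fin.snocEquiv fun _ : Fin (k + 1) => A).sum_comp,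
    Fintype.sum_prod_type_right]
  refine Finset.sum_congr rfl fun v _ => ?_
  rw [Finset.mul_sum]
  refine Finset.sum_congr rfl fun c _ => ?_
  have hv : MeasurableSet {x : ℕ → A | ∀ i : Fin k, x i = v i} := by
    simp only [Set.ofPred_forall]
    exact .iInter fun i => (measurableSet_singleton (v i)).preimage (measurable_pi_apply _)
  have ht : transProb k μ (Fin.snocEquiv (fun _ : Fin (k + 1) => A) (c, v)) =
      μ[{x | x k = c} | {x | ∀ i : Fin k, x i = v i}] := by
    simp [transProb, Fin.snocEquiv]
  have hs : (fun x : ℕ → A => window k x 0) ⁻¹'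
      {Fin.snocEquiv (fun _ : Fin (k + 1) => A) (c, v)} =
      {x | ∀ i : Fin k, x i = v i} ∩ {x | x k = c} := by
    ext x
    simp [window, Fin.snocEquiv, funext_iff, Fin.forall_fin_succ']
  rw [ht, smul_eq_mul, map_measureReal_apply hw (measurableSet_singleton _), hs, Measure.real,
    ← cond_mul_eq_inter hv, ENNReal.toReal_mul, Measure.real]
  ring

variable {k : ℕ} {μ : Measure (ℕ → A)} [IsProbabilityMeasure μ]

/-- Each letter after the `k`-th contributes the conditional entropy to the entropy of a prefix. -/
theorem IsMarkovSource.prefixLog_add [Fintype A] (hμ : IsMarkovSource k μ)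
    (hs : IsStationarySource μ) (r : ℕ) :
    prefixLog μ (k + r) = prefixLog μ k - r * condEntropy k μ := by
  induction r with
  | zero => simp
  | succ r ih =>
    have hi : Integrable (fun x => Real.logb 2 (transProb k μ (window k x r)).toReal) μ :=
      integrable_of_prefix μ (r + k + 1) _ fun x z h => by
        rw [show window k x r = window k z r from funext fun j => h _ (by omega)]
    have hstep : ∫ x, Real.logb 2 (transProb k μ (window k x r)).toReal ∂μ = -condEntropy k μ := by
      have h := hs.measurePreserving_shift r
      have h0 : AEStronglyMeasurable
          (fun x => Real.logb 2 (transProb k μ (window k x 0)).toReal) μ :=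
        ((measurable_of_finite fun s => Real.logb 2 (transProb k μ s).toReal).comp
          (measurable_window k 0)).aestronglyMeasurable
      have := integral_map h.measurable.aemeasurable (h.map_eq.symm ▸ h0)
      rw [h.map_eq, integral_logb_transProb] at this
      simpa only [window_shift] using this.symm
    have hae : prefixLog μ (k + (r + 1)) = ∫ x, (Real.logb 2 (μ.real (prefixSet (k + r) x)) +
        Real.logb 2 (transProb k μ (window k x r)).toReal) ∂μ := by
      refine integral_congr_ae ?_
      filter_upwards [ae_measure_prefixSet_ne_zero μ (k + r + 1)] with x hx
      have h1 := hμ.measure_prefixSet_succ (Nat.le_add_right k r) x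
      rw [Nat.add_sub_cancel_left] at h1
      have h2 : μ.real (prefixSet (k + r + 1) x) ≠ 0 := (measureReal_ne_zero_iff).2 hx
      rw [Measure.real, h1, ENNReal.toReal_mul] at h2
      rw [← add_assoc, Measure.real, h1, ENNReal.toReal_mul,
        Real.logb_mul (left_ne_zero_of_mul h2) (right_ne_zero_of_mul h2), Measure.real]
    rw [hae, integral_add (integrable_logb_prefixSet μ _) hi, hstep]
    change prefixLog μ (k + r) + _ = _
    rw [ih]
    push_cast
    ring

end Entropy

/-! ### Entropy of the type -/

/-- The entropy of a random variable with finitely many values is at most the logarithm of their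
number. -/
theorem neg_logb_card_le_integral {Ω τ : Type*} [MeasurableSpace Ω] {μ : Measure Ω}
    [IsProbabilityMeasure μ] [Fintype τ] [MeasurableSpace τ] [DiscreteMeasurableSpace τ]
    {φ : Ω → τ} (hφ : Measurable φ) :
    -Real.logb 2 (Fintype.card τ) ≤ ∫ x, Real.logb 2 (μ.real (φ ⁻¹' {φ x})) ∂μ := by
  have := Measure.isProbabilityMeasure_map (μ := μ) hφ.aemeasurable
  set p : τ → ℝ := fun t => μ.real (φ ⁻¹' {t})
  have hpm : ∀ t, (μ.map φ).real {t} = p t := fun t =>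
    map_measureReal_apply hφ (measurableSet_singleton t)
  have hsum : ∑ t, p t = 1 := by
    simp_rw [← hpm]
    simp
  obtain ⟨x₀⟩ := nonempty_of_isProbabilityMeasure μ
  have hM : (0 : ℝ) < Fintype.card τ := by
    exact_mod_cast Fintype.card_pos_iff.2 ⟨φ x₀⟩
  have hint : ∫ x, Real.logb 2 (μ.real (φ ⁻¹' {φ x})) ∂μ = ∑ t, p t * Real.logb 2 (p t) := by
    rw [← integral_map (φ := φ) hφ.aemeasurable (f := fun t => Real.logb 2 (p t))
      (measurable_of_finite _).aestronglyMeasurable, integral_fintype Integrable.of_finite]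
    simp [hpm]
  -- Gibbs' inequality against the uniform distribution, by `log x ≤ x - 1` at `x = 1 / (p t * M)`
  have hterm : ∀ t, -(p t * Real.log (p t)) ≤
      1 / Fintype.card τ - p t + p t * Real.log (Fintype.card τ) := by
    intro t
    have hpos : 0 ≤ p t := measureReal_nonneg
    rcases hpos.eq_or_lt with h0 | h0
    · simp [← h0]
    · have h1 := Real.log_le_sub_one_of_pos (x := 1 / (p t * Fintype.card τ)) (by positivity)
      rw [one_div, Real.log_inv, Real.log_mul h0.ne' hM.ne'] at h1
      have h2 := mul_le_mul_of_nonneg_left h1 h0.le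
      have h3 : p t * ((p t * Fintype.card τ)⁻¹ - 1) = 1 / Fintype.card τ - p t := by
        field_simp
      rw [h3] at h2
      linarith
  have hlog : -∑ t, p t * Real.log (p t) ≤ Real.log (Fintype.card τ) := by
    rw [← Finset.sum_neg_distrib]
    refine (Finset.sum_le_sum fun t _ => hterm t).trans_eq ?_
    rw [Finset.sum_add_distrib, Finset.sum_sub_distrib, ← Finset.sum_mul, hsum]
    simp [Finset.card_univ, hM.ne']
  rw [hint]
  simp only [Real.logb, ← mul_div_assoc]
  rw [← Finset.sum_div, ← neg_div]
  gcongr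
  linarith

section Types

variable {A : Type*} {k n : ℕ}

theorem occ_le (u : Fin n → A) (s : Fin (k + 1) → A) : occ k u s ≤ n := by
  have h : {i : ℕ | ∃ h : i + k < n, ∀ j : Fin (k + 1), u ⟨i + j, by omega⟩ = s j} ⊆
      (Finset.range n : Finset ℕ) := fun i ⟨h, _⟩ => by simp; omega
  exact (Set.ncard_le_ncard h).trans_eq (by rw [Set.ncard_coe_finset, Finset.card_range])

/-- The data that determine `S_u`: the subword counts, the first `k` and the last `k` symbols. -/
def typeData (hn : k ≤ n) (u : Fin n → A) :
    ((Fin (k + 1) → A) → Fin (n + 1)) × (Fin k → A) × (Fin k → A) :=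
  (fun s => ⟨occ k u s, Nat.lt_succ_of_le (occ_le u s)⟩, fun j => u ⟨j, by omega⟩,
    fun j => u ⟨n - k + j, by omega⟩)

theorem typeData_eq_iff (hn : k ≤ n) (u v : Fin n → A) :
    typeData hn v = typeData hn u ↔ v ∈ typeClass k u := by
  rw [mem_typeClass]
  simp only [typeData, Prod.mk.injEq, funext_iff, Fin.mk.injEq, typeSet, Set.mem_ofPred_eq]
  refine and_congr_right fun _ => ⟨fun ⟨h1, h2⟩ t ht => ?_, fun h => ⟨fun j => ?_, fun j => ?_⟩⟩
  · by_cases hk : (t : ℕ) < k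
    · exact h1 ⟨t, hk⟩
    · have hkt : n ≤ t + k := ht.resolve_left hk
      have := h2 ⟨t - (n - k), by omega⟩
      simpa only [Nat.add_sub_cancel' (show n - k ≤ (t : ℕ) by omega)] using this
  · exact h _ (Or.inl j.2)
  · exact h _ (Or.inr (by simp only; omega))

variable [Fintype A] [MeasurableSpace A] [DiscreteMeasurableSpace A] {μ : Measure (ℕ → A)}
  [IsProbabilityMeasure μ]

/-- Given its type, a block is uniformly distributed on its type class, so the entropy of the block
is the expected value of `log |S_u|` plus the entropy of the type, and the number of types is
polynomial in `n`. -/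
theorem IsMarkovSource.integral_logb_card (hμ : IsMarkovSource k μ) (hn : k ≤ n) :
    -prefixLog μ n - (Fintype.card (Fin (k + 1) → A) * Real.logb 2 (n + 1) +
        Real.logb 2 (Fintype.card ((Fin k → A) × (Fin k → A)))) ≤
      ∫ x, Real.logb 2 (typeClass k (block n x 0)).card ∂μ ∧
    ∫ x, Real.logb 2 (typeClass k (block n x 0)).card ∂μ ≤ -prefixLog μ n := by
  let P : (ℕ → A) → ℝ := fun x => μ.real {z | typeData hn (block n z 0) = typeData hn (block n x 0)}
  have hb : ∀ x z : ℕ → A, (∀ i < n, x i = z i) → block n x 0 = block n z 0 := fun x z h =>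
    funext fun t => h _ (by simp)
  have hPi : Integrable (fun x => Real.logb 2 (P x)) μ :=
    integrable_of_prefix μ n _ fun x z h => by simp only [P, hb x z h]
  have hP : ∀ x, P x = (typeClass k (block n x 0)).card * μ.real (prefixSet n x) := by
    intro x
    have h := hμ.measure_forall_mem_typeClass hn 1 x
    simp only [Nat.lt_one_iff, forall_eq, Finset.prod_range_one, mul_one] at h
    simp only [P, typeData_eq_iff, mem_typeClass_comm (v := block n _ 0) (u := block n x 0),
      Measure.real, h, ENNReal.toReal_mul, ENNReal.toReal_natCast]
  have hE : ∫ x, Real.logb 2 (typeClass k (block n x 0)).card ∂μ =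
      ∫ x, Real.logb 2 (P x) ∂μ - prefixLog μ n := by
    rw [prefixLog, ← integral_sub hPi (integrable_logb_prefixSet μ n)]
    refine integral_congr_ae ?_
    filter_upwards [ae_measure_prefixSet_ne_zero μ n] with x hx
    have h1 : ((typeClass k (block n x 0)).card : ℝ) ≠ 0 := by
      exact_mod_cast (typeClass_card_pos k _).ne'
    rw [hP, Real.logb_mul h1 ((measureReal_ne_zero_iff).2 hx), add_sub_cancel_right]
  have hup : ∫ x, Real.logb 2 (P x) ∂μ ≤ 0 := integral_nonpos fun x =>
    Real.logb_nonpos (by norm_num) measureReal_nonneg measureReal_le_one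
  have hlow : -(Fintype.card (Fin (k + 1) → A) * Real.logb 2 (n + 1) +
      Real.logb 2 (Fintype.card ((Fin k → A) × (Fin k → A)))) ≤ ∫ x, Real.logb 2 (P x) ∂μ := by
    classical
    obtain ⟨x₀⟩ := nonempty_of_isProbabilityMeasure μ
    have hc : (Fintype.card ((Fin k → A) × (Fin k → A)) : ℝ) ≠ 0 := by
      exact_mod_cast (Fintype.card_pos_iff.2 ⟨(fun j : Fin k => x₀ j, fun j : Fin k => x₀ j)⟩).ne'
    have h := neg_logb_card_le_integral (μ := μ) (φ := fun x => typeData hn (block n x 0))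
      ((measurable_of_finite (typeData hn)).comp (measurable_block n 0))
    rw [Fintype.card_prod, Nat.cast_mul, Fintype.card_fun, Fintype.card_fin, Nat.cast_pow,
      Real.logb_mul (by positivity) hc, Real.logb_pow, Nat.cast_succ] at h
    exact h
  rw [hE]
  constructor <;> linarith

end Types

/-! ### The limit of the rate -/

section Limit

variable {A : Type*} [Fintype A] [MeasurableSpace A] [DiscreteMeasurableSpace A] {k : ℕ}
  {μ : Measure (ℕ → A)} [IsProbabilityMeasure μ]

theorem IsMarkovSource.tendsto_rate (hμ : IsMarkovSource k μ) (hs : IsStationarySource μ)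
    (ord : ∀ (n : ℕ) (S : Finset (Fin n → A)), Fin S.card ≃ S) (Δ : DeltaSampler) {T : ℕ → ℕ}
    (hT : ∀ n, 0 < T n) :
    Tendsto (fun n => (markovSystem k (ord n) Δ).rate μ (T n)) atTop (𝓝 (condEntropy k μ)) := by
  set h := condEntropy k μ with hh
  set c := Fintype.card (Fin (k + 1) → A)
  set d := Real.logb 2 (Fintype.card ((Fin k → A) × (Fin k → A)))
  set C := -prefixLog μ k - k * h
  have hint : ∀ n (f : (Fin n → A) → ℝ), Integrable (fun x => f (block n x 0)) μ := fun n f =>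
    integrable_of_prefix μ n _ fun x z h => congrArg f (funext fun t => h _ (by simp))
  have hbound : ∀ᶠ n : ℕ in atTop,
      h + (C - 3 - d) / n - c / Real.log 2 * (Real.log (n + 1) / n) ≤
        (markovSystem k (ord n) Δ).rate μ (T n) ∧
      (markovSystem k (ord n) Δ).rate μ (T n) ≤ h + C / n := by
    filter_upwards [eventually_ge_atTop k, eventually_gt_atTop 0] with n hkn hn
    have hn' : (0 : ℝ) < n := by exact_mod_cast hn
    have hF := hμ.prefixLog_add hs (n - k)
    rw [Nat.add_sub_cancel' hkn, Nat.cast_sub hkn, ← hh] at hF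
    obtain ⟨h1, h2⟩ := hμ.integral_logb_card hkn
    have h3 : ∫ x, meanBits Δ (typeClass k (block n x 0)).card ∂μ ≤
        ∫ x, Real.logb 2 (typeClass k (block n x 0)).card ∂μ :=
      integral_mono (hint n fun u => meanBits Δ (typeClass k u).card)
        (hint n fun u => Real.logb 2 (typeClass k u).card)
        fun x => meanBits_le Δ (typeClass_card_pos k _).ne'
    have h4 : ∫ x, Real.logb 2 (typeClass k (block n x 0)).card ∂μ - 3 ≤
        ∫ x, meanBits Δ (typeClass k (block n x 0)).card ∂μ := by
      have := integral_mono ((hint n fun u => Real.logb 2 (typeClass k u).card).sub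
        (integrable_const 3)) (hint n fun u => meanBits Δ (typeClass k u).card)
        fun x => logb_sub_le_meanBits Δ (typeClass_card_pos k (block n x 0)).ne'
      simp only [Pi.sub_apply] at this
      rw [integral_sub (hint n fun u => Real.logb 2 (typeClass k u).card)
        (integrable_const 3)] at this
      simpa using this
    rw [hs.rate_eq (ord n) Δ (hT n), le_div_iff₀ hn', div_le_iff₀ hn']
    rw [Real.logb] at h1
    constructor
    · have : (h + (C - 3 - d) / n - c / Real.log 2 * (Real.log (n + 1) / n)) * n =
          h * n + (C - 3 - d) - c * (Real.log (n + 1) / Real.log 2) := by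
        field_simp
      rw [this]
      linarith
    · have : (h + C / n) * n = h * n + C := by field_simp
      rw [this]
      linarith
  have hdiv : ∀ e : ℝ, Tendsto (fun n : ℕ => e / (n : ℝ)) atTop (𝓝 0) := fun e =>
    tendsto_const_div_atTop_nhds_zero_nat e
  have hlog : Tendsto (fun n : ℕ => Real.log ((n : ℝ) + 1) / n) atTop (𝓝 0) := by
    have h1 : Tendsto (fun n : ℕ => (n : ℝ) + 1) atTop atTop :=
      tendsto_atTop_add_const_right _ _ tendsto_natCast_atTop_atTop
    have h2 := Real.isLittleO_log_id_atTop.comp_tendsto h1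
    have h3 : (id ∘ fun n : ℕ => (n : ℝ) + 1) =O[atTop] fun n : ℕ => (n : ℝ) := by
      refine Asymptotics.IsBigO.of_bound 2 ?_
      filter_upwards [eventually_ge_atTop 1] with n hn
      have hn : (1 : ℝ) ≤ n := by exact_mod_cast hn
      simp only [Function.comp_def, id, Real.norm_natCast]
      rw [Real.norm_of_nonneg (by positivity)]
      linarith
    exact (h2.trans_isBigO h3).tendsto_div_nhds_zero
  refine tendsto_of_tendsto_of_tendsto_of_le_of_le' ?_ ?_ (hbound.mono fun n h => h.1)
    (hbound.mono fun n h => h.2)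
  · simpa using ((hdiv (C - 3 - d)).const_add h).sub (hlog.const_mul (c / Real.log 2))
  · simpa using (hdiv C).const_add h

end Limit

end Stego

end

theorem theorem2 {A : Type*} [Countable A] [MeasurableSpace A] [DiscreteMeasurableSpace A]
    (k : ℕ)
    (ord : ∀ (n : ℕ) (S : Finset (Fin n → A)), Fin S.card ≃ S)
    (Δ : DeltaSampler)
    (μ : Measure (ℕ → A)) [IsProbabilityMeasure μ] (hμ : IsMarkovSource k μ) :
    (∀ (n : ℕ) (hn : 2 * k < n),
      (∀ u y δ, (markovSystem k (ord n) Δ).encode u y δ ∈ typeSet k u) ∧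
      (markovSystem k (ord n) Δ).PerfectlySecure (by omega) μ) ∧
    (∀ [Fintype A], IsStationarySource μ →
      (∀ n T : ℕ, Integrable (fun ω => ((markovSystem k (ord n) Δ).hiddenBits ω T : ℝ))
        (protocolMeasure μ)) ∧
      ∀ T : ℕ → ℕ, (∀ n, 0 < T n) →
        Tendsto (fun n => (markovSystem k (ord n) Δ).rate μ (T n)) atTop
          (𝓝 (condEntropy k μ))) := by
  refine ⟨fun n hn => ⟨fun u y δ => mem_typeClass.1 (encodeBlock_mem k (ord n) Δ u y δ),
    hμ.perfectlySecure (ord n) Δ (by omega) (by omega)⟩, ?_⟩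
  intro _ hs
  exact ⟨fun n T => integrable_hiddenBits μ (ord n) Δ T, fun T hT => hμ.tendsto_rate hs ord Δ hT⟩
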